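/- Consider the class of real equations \[ u_t+u^nu_x+h(t)u+g(t)u_{xxx}=0,\qquad ng\neq0, \] where $n$ is a nonzero real constant and $g,h$ are smooth functions on an open interval of the $t$-axis, $g$ vanishing nowhere. The power $u^n$ is considered where it is defined and smooth: for all $u$ if $n\in\mathbb N$, for $u\ne0$ if $n$ is a negative integer, and for $u>0$ if $n\notin\mathbb Z$. A point transformation $\tilde t=T(t,x,u)$, $\tilde x=X(t,x,u)$, $\tilde u=U(t,x,u)$, smooth and with nonvanishing Jacobian on an open set $\Omega$, connects two equations of the class if it maps $\Omega$ into the domain of the second equation and its prolongation maps the manifold that the first equation defines in the third-order jet space over $\Omega$ to the one defined by the second, i.e. for every jet over $\Omega$ at which the prolongation is defined, the jet satisfies the first equation if and only if its image satisfies the second. For a value of $n$, an equivalence transformation over $\Omega$ is a point transformation of $(t,x,u)$ together with expressions of $\tilde n,\tilde g,\tilde h$ through $(t,x,u,g,h)$, with $(t,x,u,g,h)\mapsto(\tilde t,\tilde x,\tilde u,\tilde g,\tilde h)$ smooth and nondegenerate, which takes every equation of the class with exponent $n$ (and with coefficients defined over $\Omega$) to an equation of the class, the two equations being connected by the transformation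 of $(t,x,u)$. These transformations constitute the equivalence group $G^\sim$. Theorem. Let $n\neq0,1$. (i) Let $\Omega$ be a connected open subset of the space of $(t,x,u)$ on which $u^n$ is defined and whose sections $t=\mathrm{const}$ are connected. The equivalence transformations over $\Omega$ are exactly \[ \tilde t=\varepsilon_1\int\theta^{-n}\,dt+\varepsilon_2,\quad \tilde x=\varepsilon_1x+\varepsilon_0,\quad \tilde u=\theta u, \] \[ \tilde g=\varepsilon_1^{2}\theta^ng,\quad \tilde h=\frac{\theta^n}{\varepsilon_1}\Bigl(h-\frac{\theta_t}{\theta}\Bigr),\quad \tilde n=n, \] where the integral is a fixed antiderivative, $\varepsilon_0,\varepsilon_1,\varepsilon_2$ are arbitrary constants with $\varepsilon_1\ne0$, and $\theta=\theta(t)$ is an arbitrary nonvanishing smooth function (positive if $n\notin\mathbb Z$, so that $\theta^n$ is defined). (ii) The class is normalized: for $\Omega$ as in (i), a point transformation on $\Omega$ connects an equation with exponent $n$ with an equation of the class (of any exponent $\tilde n\ne0$) if and only if there is an equivalence transformation over $\Omega$ which has it as its $(t,x,u)$-part and takes the first equation to the second. (iii) Every equation of the class with exponent $n$ is taken, on its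 whole domain, by an equivalence transformation of the form in (i) to an equation of the class with $\tilde h=0$. -/

import Mathlib

open scoped ContDiff

namespace GKdV

/-- The real numbers `u` at which the power `u ^ n` with the real exponent `n` is defined and smooth
in `u`: every `u` if `n` is a natural number, every `u ≠ 0` if `n` is an integer, and `u > 0` for
all other `n`. (At these `u`, `Real.rpow` is the usual power, also for `u < 0`.) -/
def powDomain (n : ℝ) : Set ℝ :=
  {u | 0 < u ∨ (u < 0 ∧ ∃ k : ℤ, n = k) ∨ (u = 0 ∧ ∃ k : ℕ, n = k)}

/-- A member of the class `u_t + u ^ n u_x + h(t) u + g(t) u_xxx = 0`, `n g ≠ 0`: the arbitrary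
elements are a nonzero real constant `n` and smooth functions `g`, `h` on an open interval `I`,
where `g` vanishes nowhere. -/
structure Equation where
  n : ℝ
  I : Set ℝ
  g : ℝ → ℝ
  h : ℝ → ℝ
  n_ne : n ≠ 0
  isOpen_I : IsOpen I
  ordConnected_I : I.OrdConnected
  nonempty_I : I.Nonempty
  g_smooth : ContDiffOn ℝ ∞ g I
  h_smooth : ContDiffOn ℝ ∞ h I
  g_ne : ∀ t ∈ I, g t ≠ 0

/-- The part of the space of the variables `(t, x, u)` on which the equation is defined. -/
def Equation.dom (E : Equation) : Set (ℝ × ℝ × ℝ) :=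
  {p | p.1 ∈ E.I ∧ p.2.2 ∈ powDomain E.n}

/-- The function `v` of `(t, x)` satisfies the equation at the point `z = (t, x)`; equivalently, the
third-order jet of `v` at `z` lies on the manifold that the equation defines in the jet space. -/
def Equation.HoldsAt (E : Equation) (v : ℝ × ℝ → ℝ) (z : ℝ × ℝ) : Prop :=
  deriv (fun t => v (t, z.2)) z.1
    + v z ^ E.n * deriv (fun x => v (z.1, x)) z.2
    + E.h z.1 * v z
    + E.g z.1 * iteratedDeriv 3 (fun x => v (z.1, x)) z.2 = 0

/-- For `Φ = (T, X, U)`, the map `(t, x) ↦ (T, X)(t, x, v(t, x))`. -/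
def baseMap (Φ : ℝ × ℝ × ℝ → ℝ × ℝ × ℝ) (v : ℝ × ℝ → ℝ) (w : ℝ × ℝ) : ℝ × ℝ :=
  ((Φ (w.1, w.2, v w)).1, (Φ (w.1, w.2, v w)).2.1)

/-- The point transformation `(t̃, x̃, ũ) = Φ(t, x, u)`, defined on the open set `Ω`, smooth and with
nonvanishing Jacobian there, connects the equation `E` with the equation `E'`: its prolongation to
third-order jets maps the manifold defined by `E` to the one defined by `E'`. The prolongation
sends the jet of `v` at `z` to the jet at `(t̃, x̃)` of the function `v'` whose graph is the image of
the graph of `v`; as usual it is considered where the image of the graph is transversal to the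
`ũ`-direction. -/
structure Connects (Ω : Set (ℝ × ℝ × ℝ)) (E E' : Equation)
    (Φ : ℝ × ℝ × ℝ → ℝ × ℝ × ℝ) : Prop where
  isOpen : IsOpen Ω
  smooth : ContDiffOn ℝ ∞ Φ Ω
  jacobian_ne : ∀ p ∈ Ω, (fderiv ℝ Φ p).det ≠ 0
  source : Ω ⊆ E.dom
  target : Set.MapsTo Φ Ω E'.dom
  jets : ∀ (v v' : ℝ × ℝ → ℝ) (z : ℝ × ℝ), (z.1, z.2, v z) ∈ Ω →
    ContDiffAt ℝ ∞ v z → ContDiffAt ℝ ∞ v' (baseMap Φ v z) →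
    (fderiv ℝ (baseMap Φ v) z).det ≠ 0 →
    (∀ᶠ w in nhds z, v' (baseMap Φ v w) = (Φ (w.1, w.2, v w)).2.2) →
    (E.HoldsAt v z ↔ E'.HoldsAt v' (baseMap Φ v z))

/-- For a given exponent `n`, the components of a transformation of the variables and the arbitrary
elements: `(t̃, x̃, ũ) = Φ(t, x, u)`, and `ñ`, `g̃`, `h̃` as functions of `(t, x, u)`, `g` and `h`. -/
structure ExtMap where
  Φ : ℝ × ℝ × ℝ → ℝ × ℝ × ℝ
  N : ℝ × ℝ × ℝ → ℝ → ℝ → ℝ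
  G : ℝ × ℝ × ℝ → ℝ → ℝ → ℝ
  H : ℝ × ℝ × ℝ → ℝ → ℝ → ℝ

/-- The transformation of the space of `(t, x, u)` and the values of `g` and `h`. -/
def ExtMap.toFun (𝒯 : ExtMap) (q : (ℝ × ℝ × ℝ) × ℝ × ℝ) : (ℝ × ℝ × ℝ) × ℝ × ℝ :=
  (𝒯.Φ q.1, 𝒯.G q.1 q.2.1 q.2.2, 𝒯.H q.1 q.2.1 q.2.2)

/-- Over `Ω`, the transformation `𝒯` takes the arbitrary elements of `E` to those of `E'`. -/
def ExtMap.Takes (𝒯 : ExtMap) (Ω : Set (ℝ × ℝ × ℝ)) (E E' : Equation) : Prop :=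
  ∀ p ∈ Ω, p.1 ∈ E.I ∧ (𝒯.Φ p).1 ∈ E'.I ∧
    E'.n = 𝒯.N p (E.g p.1) (E.h p.1) ∧
    E'.g (𝒯.Φ p).1 = 𝒯.G p (E.g p.1) (E.h p.1) ∧
    E'.h (𝒯.Φ p).1 = 𝒯.H p (E.g p.1) (E.h p.1)

/-- `𝒯` is, over the open set `Ω` of the space of `(t, x, u)`, an equivalence transformation of the
class at the exponent `n`: a nondegenerate smooth transformation of the variables and the arbitrary
elements, projectable to the variables, that takes *every* equation of the class with exponent `n`
to an equation of the class, the two equations being connected by the projection. -/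
structure IsEquivalence (n : ℝ) (Ω : Set (ℝ × ℝ × ℝ)) (𝒯 : ExtMap) : Prop where
  isOpen : IsOpen Ω
  smooth : ContDiffOn ℝ ∞ 𝒯.toFun (Ω ×ˢ {a : ℝ × ℝ | a.1 ≠ 0})
  jacobian_ne : ∀ q ∈ Ω ×ˢ {a : ℝ × ℝ | a.1 ≠ 0}, (fderiv ℝ 𝒯.toFun q).det ≠ 0
  preserves : ∀ E : Equation, E.n = n → Prod.fst '' Ω ⊆ E.I →
    ∃ E' : Equation, 𝒯.Takes Ω E E' ∧ Connects Ω E E' 𝒯.Φ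

/-- Over `Ω`, the transformation `𝒯` is
`t̃ = ε₁ ∫ θ ^ (-n) dt + ε₂`, `x̃ = ε₁ x + ε₀`, `ũ = θ u`,
`ñ = n`, `g̃ = ε₁ ^ 2 θ ^ n g`, `h̃ = (θ ^ n / ε₁) (h - θ_t / θ)`,
with `ε₁ ≠ 0` and a nonvanishing smooth function `θ` of `t` whose power `θ ^ n` is defined. The
antiderivative is the one that vanishes at `t₀`. -/
structure HasForm (n : ℝ) (Ω : Set (ℝ × ℝ × ℝ)) (t₀ ε₀ ε₁ ε₂ : ℝ) (θ : ℝ → ℝ)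
    (𝒯 : ExtMap) : Prop where
  ε₁_ne : ε₁ ≠ 0
  θ_smooth : ContDiffOn ℝ ∞ θ (Prod.fst '' Ω)
  θ_ne : ∀ t ∈ Prod.fst '' Ω, θ t ≠ 0 ∧ θ t ∈ powDomain n
  t_eq : ∀ p ∈ Ω, (𝒯.Φ p).1 = ε₁ * (∫ s in t₀..p.1, θ s ^ (-n)) + ε₂
  x_eq : ∀ p ∈ Ω, (𝒯.Φ p).2.1 = ε₁ * p.2.1 + ε₀
  u_eq : ∀ p ∈ Ω, (𝒯.Φ p).2.2 = θ p.1 * p.2.2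
  n_eq : ∀ p ∈ Ω, ∀ a b : ℝ, a ≠ 0 → 𝒯.N p a b = n
  g_eq : ∀ p ∈ Ω, ∀ a b : ℝ, a ≠ 0 → 𝒯.G p a b = ε₁ ^ 2 * θ p.1 ^ n * a
  h_eq : ∀ p ∈ Ω, ∀ a b : ℝ, a ≠ 0 →
    𝒯.H p a b = θ p.1 ^ n / ε₁ * (b - deriv θ p.1 / θ p.1)

/-- The domains on which transformations are considered: connected open sets of the space of
`(t, x, u)` on which `u ^ n` is defined, with connected sections `t = const`. Every open box (with
`u ^ n` defined on it) is one. -/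
structure IsRegularDomain (n : ℝ) (Ω : Set (ℝ × ℝ × ℝ)) : Prop where
  isOpen : IsOpen Ω
  isConnected : IsConnected Ω
  sections : ∀ t : ℝ, IsPreconnected {y : ℝ × ℝ | (t, y) ∈ Ω}
  pow_defined : ∀ p ∈ Ω, p.2.2 ∈ powDomain n

end GKdV

/-!
Write a transformation as `(T, X, U)`. A diagonal one, `(τ(t), ε₁ x + ε₀, θ(t) u)` with
`τ' = ε₁ θ ^ (-n)`, multiplies the left-hand side of the equation by `θ ^ (n + 1) / ε₁` and changes
`g` and `h` as stated (`holdsAt_iff_of_diagonal`); as `τ` has a smooth inverse on an interval, the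
image is again an equation of the class (`HasForm.exists_target`, `HasForm.isEquivalence`). With
`θ = exp ∫ h` the new `h` vanishes (`exists_gauge`).

For the converse, let `(T, X, U)` connect two equations. A jet on the first equation is represented
by a polynomial `v`; if the map `w ↦ (T, X)(w, v w)` is locally invertible, `v` has an image `v'`,
whose jet lies on the second equation (`Connects.exists_image`). Jets on the first equation are
varied, and the effect on the second is compared. The third derivatives of the images are not
computed from prolongation formulas. If `v₂ - v₁` vanishes to third order along the preimage of a
line `t̃ = const`, the difference of the images along this line is `v₂ - v₁` times
`U_u - v'_t̃ T_u - v'_x̃ X_u`, up to higher order (`prolongation_contact`), and this factor does not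
vanish (`Connects.characteristic_ne_zero`).

* Adding `(t - t₀) ^ 3` to `v` does not affect the first equation; for the second one this means
  that `T_x + T_u v_x = 0` for generic `v_x`, so that `T` is a function of `t`
  (`Connects.dx_T_du_T_eq_zero`).
* Adding `(x - x₀) ^ 3 - 6 g (t - t₀)` gives `g̃ T_t = g (X_x + X_u v_x) ^ 3` for generic `v_x`, so
  that `X_u = 0` and `X_x` is a function of `t` (`Connects.g_mul_total_dx_X`).
* Now `X` is affine in `x` on each section `t = const`, and the `x`-derivatives of the image are
  those of `U(t, x, v)` up to constant factors. The coefficient of `v_xx` shows that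
  `U_uu = U_xu = 0` (`Connects.second_derivs_U`), that of `v_x` that `U ^ ñ T_t = X_x u ^ n + X_t`
  (`Connects.power_relation`).
* Two differentiations in `u` turn the last relation into `(ñ - 1) U_u u = (n - 1) U`, and a third
  one gives `ñ = n` (`Connects.exponent_eq`). As `n ≠ 1`, `U = U_u u`, hence `X_t = 0` and
  `U_u ^ n T_t = X_x`. The remaining terms of the equation determine `h̃`
  (`Connects.h_relation`).

The local identities hold globally with constants and functions of `t` because the domain and its
sections are connected (`Connects.exists_form`). The coefficients of the second equation are thus
determined by the transformation and the first equation (`Connects.coefficients`), which gives the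
equivalence group when applied to equations with constant coefficients, and normalization.
-/


namespace GKdV

open Filter Topology

/-! ### Powers -/

lemma mem_powDomain_of_pos {n u : ℝ} (hu : 0 < u) : u ∈ powDomain n := Or.inl hu

lemma pos_or_int {n u : ℝ} (hu : u ∈ powDomain n) : 0 < u ∨ ∃ k : ℤ, n = k := by
  rcases hu with h | ⟨-, h⟩ | ⟨-, k, h⟩
  · exact Or.inl h
  · exact Or.inr h
  · exact Or.inr ⟨k, by simpa using h⟩

lemma mul_rpow_of_mem {n θ u : ℝ} (hθ : θ ∈ powDomain n) (hu : u ∈ powDomain n) :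
    (θ * u) ^ n = θ ^ n * u ^ n := by
  rcases pos_or_int hθ with h1 | ⟨k, rfl⟩
  · rcases pos_or_int hu with h2 | ⟨k, rfl⟩
    · exact Real.mul_rpow h1.le h2.le
    · simp only [Real.rpow_intCast]; exact mul_zpow _ _ _
  · simp only [Real.rpow_intCast]; exact mul_zpow _ _ _

lemma rpow_neg_of_mem {n θ : ℝ} (hθ : θ ∈ powDomain n) : θ ^ (-n) = (θ ^ n)⁻¹ := by
  rcases pos_or_int hθ with h1 | ⟨k, rfl⟩
  · exact Real.rpow_neg h1.le n
  · rw [← Int.cast_neg]; simp only [Real.rpow_intCast]; exact zpow_neg _ _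

lemma rpow_ne_zero_of_mem {n θ : ℝ} (hθ : θ ∈ powDomain n) (h0 : θ ≠ 0) : θ ^ n ≠ 0 := by
  rcases pos_or_int hθ with h1 | ⟨k, rfl⟩
  · exact (Real.rpow_pos_of_pos h1 n).ne'
  · simp only [Real.rpow_intCast]; exact zpow_ne_zero _ h0

lemma mul_mem_powDomain {n θ u : ℝ} (hθ : θ ∈ powDomain n) (h0 : θ ≠ 0) (hu : u ∈ powDomain n) :
    θ * u ∈ powDomain n := by
  rcases hu with h | ⟨h, k, rfl⟩ | ⟨rfl, h⟩
  · rcases hθ with h1 | ⟨h1, hk⟩ | ⟨h1, -⟩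
    · exact Or.inl (mul_pos h1 h)
    · exact Or.inr (Or.inl ⟨mul_neg_of_neg_of_pos h1 h, hk⟩)
    · exact absurd h1 h0
  · rcases lt_or_gt_of_ne h0 with h1 | h1
    · exact Or.inl (mul_pos_of_neg_of_neg h1 h)
    · exact Or.inr (Or.inl ⟨mul_neg_of_pos_of_neg h1 h, k, rfl⟩)
  · exact Or.inr (Or.inr ⟨mul_zero _, h⟩)

/-- For a nonintegral exponent `u` and `θ u` are positive, hence so is `θ`; for an integral one any
`θ ≠ 0` will do. -/
lemma mem_powDomain_of_mul {n θ u : ℝ} (h0 : θ ≠ 0) (hu : u ∈ powDomain n)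
    (hθu : θ * u ∈ powDomain n) : θ ∈ powDomain n := by
  rcases lt_or_gt_of_ne h0 with h1 | h1
  · refine Or.inr (Or.inl ⟨h1, ?_⟩)
    rcases pos_or_int hu with h2 | h2
    · rcases pos_or_int hθu with h3 | h3
      · exact absurd h3 (mul_neg_of_neg_of_pos h1 h2).not_gt
      · exact h3
    · exact h2
  · exact Or.inl h1

/-! ### Linear maps -/

lemma det_ne_zero_of_injective {V : Type*} [NormedAddCommGroup V] [NormedSpace ℝ V]
    [FiniteDimensional ℝ V] (L : V →L[ℝ] V) (h : ∀ v, L v = 0 → v = 0) : L.det ≠ 0 := by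
  intro hd
  have := LinearMap.bot_lt_ker_of_det_eq_zero (f := (L : V →ₗ[ℝ] V)) hd
  apply this.ne'
  rw [LinearMap.ker_eq_bot']
  exact h

lemma exists_eq_of_det_ne_zero {V : Type*} [NormedAddCommGroup V] [NormedSpace ℝ V]
    [FiniteDimensional ℝ V] (L : V →L[ℝ] V) (h : L.det ≠ 0) (w : V) : ∃ v, L v = w :=
  ⟨(L.toContinuousLinearEquivOfDetNeZero h).symm w, by
    rw [← ContinuousLinearMap.toContinuousLinearEquivOfDetNeZero_apply L h]
    simp⟩

/-! ### Functions of one variable -/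

lemma contDiffOn_rpow {I : Set ℝ} {θ : ℝ → ℝ} (hθ : ContDiffOn ℝ ∞ θ I) (h0 : ∀ t ∈ I, θ t ≠ 0)
    (n : ℝ) : ContDiffOn ℝ ∞ (fun t => θ t ^ n) I := fun t ht =>
  (Real.contDiffAt_rpow_const_of_ne (h0 t ht)).comp_contDiffWithinAt t (hθ t ht)

lemma hasDerivAt_integral {I : Set ℝ} (hI : IsOpen I) (hc : I.OrdConnected) {f : ℝ → ℝ}
    (hf : ContinuousOn f I) {t₀ t : ℝ} (h0 : t₀ ∈ I) (ht : t ∈ I) :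
    HasDerivAt (fun t => ∫ s in t₀..t, f s) (f t) t := by
  apply intervalIntegral.integral_hasDerivAt_right
  · exact (hf.mono (hc.uIcc_subset h0 ht)).intervalIntegrable
  · exact hf.stronglyMeasurableAtFilter hI t ht
  · exact hf.continuousAt (hI.mem_nhds ht)

lemma contDiffOn_of_hasDerivAt {I : Set ℝ} (hI : IsOpen I) {F f : ℝ → ℝ}
    (hf : ContDiffOn ℝ ∞ f I) (hF : ∀ t ∈ I, HasDerivAt F (f t) t) : ContDiffOn ℝ ∞ F I := by
  rw [contDiffOn_infty_iff_deriv_of_isOpen hI]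
  exact ⟨fun t ht => (hF t ht).differentiableAt.differentiableWithinAt,
    hf.congr fun t ht => (hF t ht).deriv⟩

lemma injOn_of_hasDerivAt_ne {I : Set ℝ} (hc : I.OrdConnected) {τ f : ℝ → ℝ}
    (hτ : ∀ t ∈ I, HasDerivAt τ (f t) t) (hf : ∀ t ∈ I, f t ≠ 0) : Set.InjOn τ I := by
  have key : ∀ a ∈ I, ∀ b ∈ I, a < b → τ a ≠ τ b := by
    intro a ha b hb hab h
    have hsub : Set.Icc a b ⊆ I := hc.out ha hb
    obtain ⟨c, hc, h0⟩ := exists_hasDerivAt_eq_zero hab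
      (fun x hx => (hτ x (hsub hx)).continuousAt.continuousWithinAt) h
      (fun x hx => hτ x (hsub (Set.Ioo_subset_Icc_self hx)))
    exact hf c (hsub (Set.Ioo_subset_Icc_self hc)) h0
  intro a ha b hb h
  by_contra hne
  rcases lt_or_gt_of_ne hne with h1 | h1
  · exact key a ha b hb h1 h
  · exact key b hb a ha h1 h.symm

/-- A smooth function on an open interval whose derivative does not vanish has a smooth inverse,
defined on an open interval. -/
lemma exists_smooth_inverse {I : Set ℝ} (hI : IsOpen I) (hc : I.OrdConnected) {τ f : ℝ → ℝ}
    (hs : ContDiffOn ℝ ∞ τ I) (hτ : ∀ t ∈ I, HasDerivAt τ (f t) t) (hf : ∀ t ∈ I, f t ≠ 0) :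
    IsOpen (τ '' I) ∧ (τ '' I).OrdConnected ∧
      ∃ σ : ℝ → ℝ, ContDiffOn ℝ ∞ σ (τ '' I) ∧ ∀ t ∈ I, σ (τ t) = t := by
  have hinj := injOn_of_hasDerivAt_ne hc hτ hf
  have hca : ∀ t ∈ I, ContDiffAt ℝ ∞ τ t := fun t ht => (hs t ht).contDiffAt (hI.mem_nhds ht)
  refine ⟨?_, ?_, Function.invFunOn τ I, ?_, fun t ht => hinj.leftInvOn_invFunOn ht⟩
  · rw [isOpen_iff_mem_nhds]
    rintro _ ⟨t, ht, rfl⟩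
    have h1 : HasStrictDerivAt τ (f t) t := (hca t ht).hasStrictDerivAt' (hτ t ht) (by simp)
    rw [← h1.map_nhds_eq (hf t ht)]
    exact image_mem_map (hI.mem_nhds ht)
  · exact ((isPreconnected_iff_ordConnected.mpr hc).image τ hs.continuousOn).ordConnected
  · rintro _ ⟨t, ht, rfl⟩
    set e : ℝ ≃L[ℝ] ℝ := ContinuousLinearEquiv.unitsEquivAut ℝ (Units.mk0 (f t) (hf t ht))
    have hd : HasFDerivAt τ (e : ℝ →L[ℝ] ℝ) t := by
      have he : (e : ℝ →L[ℝ] ℝ) = ContinuousLinearMap.toSpanSingleton ℝ (f t) := by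
        ext; simp [e]
      rw [he]
      exact (hτ t ht).hasFDerivAt
    have hl := (hca t ht).to_localInverse hd (by simp)
    refine (hl.congr_of_eventuallyEq ?_).contDiffWithinAt
    have hst := (hca t ht).hasStrictFDerivAt' hd (by simp)
    have h1 := hst.eventually_right_inverse
    have h2 : ∀ᶠ y in 𝓝 (τ t), (hca t ht).localInverse hd (by simp) y ∈ I := by
      apply hl.continuousAt.eventually_mem
      rw [ContDiffAt.localInverse_apply_image]
      exact hI.mem_nhds ht
    filter_upwards [h1, h2] with y hy1 hy2
    have hy : y ∈ τ '' I := ⟨_, hy2, hy1⟩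
    exact hinj (Function.invFunOn_mem hy) hy2 ((Function.invFunOn_eq hy).trans hy1.symm)

lemma coeffs_of_tendsto {a b c d L : ℝ}
    (h : Tendsto (fun s : ℝ => (a + b * s + c * s ^ 2 + d * s ^ 3) / s ^ 3) (𝓝[≠] 0) (𝓝 L)) :
    a = 0 ∧ b = 0 ∧ d = L := by
  have hne : ∀ᶠ s : ℝ in 𝓝[≠] 0, s ≠ 0 := eventually_mem_nhdsWithin
  have hp : ∀ p : ℝ → ℝ, Continuous p → Tendsto p (𝓝[≠] 0) (𝓝 (p 0)) := fun p hp =>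
    hp.continuousAt.tendsto.mono_left nhdsWithin_le_nhds
  have ha : a = 0 := by
    have h1 := h.mul (hp (fun s => s ^ 3) (by fun_prop))
    have h2 := hp (fun s => a + b * s + c * s ^ 2 + d * s ^ 3) (by fun_prop)
    have h3 := tendsto_nhds_unique (h2.congr' (by
      filter_upwards [hne] with s hs; field_simp)) h1
    simpa using h3
  subst ha
  have hb : b = 0 := by
    have h1 := h.mul (hp (fun s => s ^ 2) (by fun_prop))
    have h2 := hp (fun s => b + c * s + d * s ^ 2) (by fun_prop)
    have h3 := tendsto_nhds_unique (h2.congr' (by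
      filter_upwards [hne] with s hs; field_simp; ring)) h1
    simpa using h3
  subst hb
  have hc : c = 0 := by
    have h1 := h.mul (hp (fun s => s) (by fun_prop))
    have h2 := hp (fun s => c + d * s) (by fun_prop)
    have h3 := tendsto_nhds_unique (h2.congr' (by
      filter_upwards [hne] with s hs; field_simp; ring)) h1
    simpa using h3
  subst hc
  refine ⟨rfl, rfl, ?_⟩
  have h2 := hp (fun s => d) (by fun_prop)
  exact tendsto_nhds_unique (h2.congr' (by
      filter_upwards [hne] with s hs; field_simp; ring)) h

/-- Third-order contact of a smooth function with zero, read off from a limit. -/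
lemma derivs_of_tendsto_div_pow_three {D : ℝ → ℝ} {L : ℝ} (hD : ContDiffAt ℝ ∞ D 0)
    (h : Tendsto (fun s => D s / s ^ 3) (𝓝[≠] 0) (𝓝 L)) :
    D 0 = 0 ∧ deriv D 0 = 0 ∧ iteratedDeriv 3 D 0 = 6 * L := by
  have h3 : ContDiffAt ℝ 3 D 0 := mod_cast contDiffAt_infty.mp hD 3
  obtain ⟨u, hu, hu'⟩ := h3.contDiffOn (m := 3) le_rfl (by simp)
  obtain ⟨r, hr, hru⟩ := Metric.mem_nhds_iff.mp hu
  have h0 : (0 : ℝ) ∈ Metric.ball (0 : ℝ) r := Metric.mem_ball_self hr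
  have hT := Real.taylor_tendsto (n := 3) (convex_ball (0 : ℝ) r) h0 (hu'.mono hru)
  rw [Metric.isOpen_ball.nhdsWithin_eq h0] at hT
  have hk : ∀ k, iteratedDerivWithin k D (Metric.ball 0 r) 0 = iteratedDeriv k D 0 := fun k =>
    iteratedDerivWithin_of_isOpen Metric.isOpen_ball h0
  have hT' := h.sub (hT.mono_left nhdsWithin_le_nhds)
  have := coeffs_of_tendsto (a := D 0) (b := deriv D 0) (c := iteratedDeriv 2 D 0 / 2)
    (d := iteratedDeriv 3 D 0 / 6) (L := L) (by
      rw [sub_zero] at hT'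
      refine hT'.congr' ?_
      filter_upwards [eventually_mem_nhdsWithin] with s hs
      have hs0 : s ≠ 0 := hs
      simp only [taylor_within_apply, Finset.sum_range_succ, hk, Finset.sum_range_zero,
        iteratedDeriv_zero, iteratedDeriv_one, smul_eq_mul, sub_zero, Nat.factorial]
      field_simp
      push_cast
      ring)
  refine ⟨this.1, this.2.1, by linarith [this.2.2]⟩

/-! ### Functions of `(t, x, u)` -/

/-- The partial derivative in `t` of a function of `(t, x, u)`. -/
noncomputable def dt (F : ℝ × ℝ × ℝ → ℝ) (p : ℝ × ℝ × ℝ) : ℝ := fderiv ℝ F p (1, 0, 0)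

/-- The partial derivative in `x` of a function of `(t, x, u)`. -/
noncomputable def dx (F : ℝ × ℝ × ℝ → ℝ) (p : ℝ × ℝ × ℝ) : ℝ := fderiv ℝ F p (0, 1, 0)

/-- The partial derivative in `u` of a function of `(t, x, u)`. -/
noncomputable def du (F : ℝ × ℝ × ℝ → ℝ) (p : ℝ × ℝ × ℝ) : ℝ := fderiv ℝ F p (0, 0, 1)

lemma fderiv_triple (F : ℝ × ℝ × ℝ → ℝ) (p : ℝ × ℝ × ℝ) (a b c : ℝ) :
    fderiv ℝ F p (a, b, c) = dt F p * a + dx F p * b + du F p * c := by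
  have : ((a, b, c) : ℝ × ℝ × ℝ) = a • (1, 0, 0) + b • (0, 1, 0) + c • (0, 0, 1) := by simp
  rw [this, map_add, map_add, map_smul, map_smul, map_smul]
  simp only [dt, dx, du, smul_eq_mul]
  ring

lemma fderiv_pair (v : ℝ × ℝ → ℝ) (z : ℝ × ℝ) (a b : ℝ) :
    fderiv ℝ v z (a, b) = fderiv ℝ v z (1, 0) * a + fderiv ℝ v z (0, 1) * b := by
  have : ((a, b) : ℝ × ℝ) = a • (1, 0) + b • (0, 1) := by simp
  rw [this, map_add, map_smul, map_smul]
  simp only [smul_eq_mul]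
  ring

section Smooth
variable {Ω : Set (ℝ × ℝ × ℝ)} {F : ℝ × ℝ × ℝ → ℝ}

lemma contDiffOn_fderiv_apply (hΩ : IsOpen Ω) (hF : ContDiffOn ℝ ∞ F Ω) (e : ℝ × ℝ × ℝ) :
    ContDiffOn ℝ ∞ (fun p => fderiv ℝ F p e) Ω :=
  ((contDiffOn_infty_iff_fderiv_of_isOpen hΩ).mp hF).2.clm_apply contDiffOn_const

lemma contDiffOn_dt (hΩ : IsOpen Ω) (hF : ContDiffOn ℝ ∞ F Ω) : ContDiffOn ℝ ∞ (dt F) Ω :=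
  contDiffOn_fderiv_apply hΩ hF _

lemma contDiffOn_dx (hΩ : IsOpen Ω) (hF : ContDiffOn ℝ ∞ F Ω) : ContDiffOn ℝ ∞ (dx F) Ω :=
  contDiffOn_fderiv_apply hΩ hF _

lemma contDiffOn_du (hΩ : IsOpen Ω) (hF : ContDiffOn ℝ ∞ F Ω) : ContDiffOn ℝ ∞ (du F) Ω :=
  contDiffOn_fderiv_apply hΩ hF _

lemma contDiffAt_of_mem (hΩ : IsOpen Ω) (hF : ContDiffOn ℝ ∞ F Ω) {p : ℝ × ℝ × ℝ} (hp : p ∈ Ω) :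
    ContDiffAt ℝ ∞ F p := (hF p hp).contDiffAt (hΩ.mem_nhds hp)

lemma hasFDerivAt_of_mem (hΩ : IsOpen Ω) (hF : ContDiffOn ℝ ∞ F Ω) {p : ℝ × ℝ × ℝ} (hp : p ∈ Ω) :
    HasFDerivAt F (fderiv ℝ F p) p :=
  ((contDiffAt_of_mem hΩ hF hp).differentiableAt (by simp)).hasFDerivAt

lemma fderiv_fderiv_comm (hΩ : IsOpen Ω) (hF : ContDiffOn ℝ ∞ F Ω) {p : ℝ × ℝ × ℝ} (hp : p ∈ Ω)
    (e e' : ℝ × ℝ × ℝ) :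
    fderiv ℝ (fun q => fderiv ℝ F q e) p e' = fderiv ℝ (fun q => fderiv ℝ F q e') p e := by
  have h1 : DifferentiableAt ℝ (fderiv ℝ F) p :=
    ((((contDiffOn_infty_iff_fderiv_of_isOpen hΩ).mp hF).2 p hp).contDiffAt
      (hΩ.mem_nhds hp)).differentiableAt (by simp)
  have hF2 : ContDiffAt ℝ 2 F p := mod_cast contDiffAt_infty.mp (contDiffAt_of_mem hΩ hF hp) 2
  have h2 := hF2.isSymmSndFDerivAt (by simp)
  rw [fderiv_clm_apply h1 (differentiableAt_const _),
    fderiv_clm_apply h1 (differentiableAt_const _)]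
  simpa using h2 e' e

lemma dx_dt_comm (hΩ : IsOpen Ω) (hF : ContDiffOn ℝ ∞ F Ω) {p : ℝ × ℝ × ℝ} (hp : p ∈ Ω) :
    dx (dt F) p = dt (dx F) p := fderiv_fderiv_comm hΩ hF hp _ _

lemma dx_du_comm (hΩ : IsOpen Ω) (hF : ContDiffOn ℝ ∞ F Ω) {p : ℝ × ℝ × ℝ} (hp : p ∈ Ω) :
    dx (du F) p = du (dx F) p := fderiv_fderiv_comm hΩ hF hp _ _

/-- The chain rule along a curve. -/
lemma hasDerivAt_comp_curve (hΩ : IsOpen Ω) (hF : ContDiffOn ℝ ∞ F Ω) {a b c : ℝ → ℝ}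
    {a' b' c' s : ℝ} (hp : (a s, b s, c s) ∈ Ω) (ha : HasDerivAt a a' s) (hb : HasDerivAt b b' s)
    (hc : HasDerivAt c c' s) :
    HasDerivAt (fun s => F (a s, b s, c s))
      (dt F (a s, b s, c s) * a' + dx F (a s, b s, c s) * b' + du F (a s, b s, c s) * c') s := by
  rw [← fderiv_triple]
  exact (hasFDerivAt_of_mem hΩ hF hp).comp_hasDerivAt_of_eq s (ha.prodMk (hb.prodMk hc)) rfl

/-- The chain rule on the graph of a function. -/
lemma fderiv_comp_graph (hΩ : IsOpen Ω) (hF : ContDiffOn ℝ ∞ F Ω) {v : ℝ × ℝ → ℝ} {z : ℝ × ℝ}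
    (hp : (z.1, z.2, v z) ∈ Ω) (hv : DifferentiableAt ℝ v z) :
    HasFDerivAt (fun w : ℝ × ℝ => F (w.1, w.2, v w))
      ((fderiv ℝ F (z.1, z.2, v z)).comp ((ContinuousLinearMap.fst ℝ ℝ ℝ).prod
        ((ContinuousLinearMap.snd ℝ ℝ ℝ).prod (fderiv ℝ v z)))) z :=
  (hasFDerivAt_of_mem hΩ hF hp).comp z
    (hasFDerivAt_fst.prodMk (hasFDerivAt_snd.prodMk hv.hasFDerivAt))

/-- A function whose `x`- and `u`-derivatives vanish on a connected section `t = const` is constant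
there. -/
lemma eq_of_section (hΩ : IsOpen Ω) (hsec : ∀ t : ℝ, IsPreconnected {y : ℝ × ℝ | (t, y) ∈ Ω})
    (hF : ContDiffOn ℝ ∞ F Ω) {p q : ℝ × ℝ × ℝ} (hx : ∀ r ∈ Ω, r.1 = p.1 → dx F r = 0)
    (hu : ∀ r ∈ Ω, r.1 = p.1 → du F r = 0) (hp : p ∈ Ω) (hq : q ∈ Ω) (h : p.1 = q.1) :
    F p = F q := by
  obtain ⟨t, y⟩ := p
  obtain ⟨t', y'⟩ := q
  obtain rfl : t = t' := h
  have hder : ∀ y : ℝ × ℝ, (t, y) ∈ Ω → HasFDerivAt (fun y => F (t, y)) (0 : ℝ × ℝ →L[ℝ] ℝ) y := by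
    intro y hy
    have h1 : HasFDerivAt (fun y : ℝ × ℝ => (t, y)) (ContinuousLinearMap.inr ℝ ℝ (ℝ × ℝ)) y :=
      hasFDerivAt_prodMk_right t y
    have h2 := (hasFDerivAt_of_mem hΩ hF hy).comp y h1
    refine h2.congr_fderiv ?_
    ext <;> simp [fderiv_triple, hx _ hy rfl, hu _ hy rfl]
  have ho : IsOpen {y : ℝ × ℝ | (t, y) ∈ Ω} := hΩ.preimage (by fun_prop)
  exact ho.is_const_of_fderiv_eq_zero (𝕜 := ℝ) (hsec t)
    (fun y hy => (hder y hy).differentiableAt.differentiableWithinAt)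
    (fun y hy => (hder y hy).fderiv) hp hq

/-- A function on the domain whose `x`- and `u`-derivatives vanish is a smooth function of `t`. -/
lemma exists_function_of_t (hΩ : IsOpen Ω)
    (hsec : ∀ t : ℝ, IsPreconnected {y : ℝ × ℝ | (t, y) ∈ Ω})
    (hF : ContDiffOn ℝ ∞ F Ω) (hx : ∀ p ∈ Ω, dx F p = 0) (hu : ∀ p ∈ Ω, du F p = 0) :
    ∃ f : ℝ → ℝ, (∀ p ∈ Ω, F p = f p.1) ∧ ContDiffOn ℝ ∞ f (Prod.fst '' Ω) ∧
      ∀ p ∈ Ω, HasDerivAt f (dt F p) p.1 := by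
  classical
  let f : ℝ → ℝ := fun t => if h : ∃ y, (t, y) ∈ Ω then F (t, h.choose) else 0
  have hf : ∀ p ∈ Ω, F p = f p.1 := by
    rintro ⟨t, y⟩ hp
    have h : ∃ y, (t, y) ∈ Ω := ⟨y, hp⟩
    simp only [f, dif_pos h]
    exact eq_of_section hΩ hsec hF (fun r hr _ => hx r hr) (fun r hr _ => hu r hr) hp
      h.choose_spec rfl
  have hev : ∀ p ∈ Ω, f =ᶠ[𝓝 p.1] fun t => F (t, p.2) := by
    rintro ⟨t, y⟩ hp
    have : ∀ᶠ s in 𝓝 t, (s, y) ∈ Ω :=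
      (show ContinuousAt (fun s : ℝ => (s, y)) t by fun_prop).eventually_mem (hΩ.mem_nhds hp)
    filter_upwards [this] with s hs
    exact (hf _ hs).symm
  refine ⟨f, hf, ?_, ?_⟩
  · rintro _ ⟨p, hp, rfl⟩
    refine (ContDiffAt.congr_of_eventuallyEq ?_ (hev p hp)).contDiffWithinAt
    exact (contDiffAt_of_mem hΩ hF (p := (p.1, p.2)) hp).comp p.1
      (contDiffAt_id.prodMk contDiffAt_const)
  · rintro ⟨t, x, u⟩ hp
    have h1 := hasDerivAt_comp_curve hΩ hF (a := fun s => s) (b := fun _ => x) (c := fun _ => u)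
      (s := t) hp (hasDerivAt_id _) (hasDerivAt_const _ _) (hasDerivAt_const _ _)
    simp only [mul_one, mul_zero, add_zero] at h1
    exact h1.congr_of_eventuallyEq (hev _ hp)

lemma exists_eq_mul_add_const (hΩ : IsOpen Ω) (hcon : IsPreconnected Ω) {p₀ : ℝ × ℝ × ℝ}
    (h₀ : p₀ ∈ Ω) (hF : ContDiffOn ℝ ∞ F Ω) (ht : ∀ p ∈ Ω, dt F p = 0)
    (hu : ∀ p ∈ Ω, du F p = 0) (hx : ∀ p ∈ Ω, dx F p = dx F p₀) :
    ∃ c, ∀ p ∈ Ω, F p = dx F p₀ * p.2.1 + c := by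
  refine ⟨F p₀ - dx F p₀ * p₀.2.1, fun p hp => ?_⟩
  have hder : ∀ p ∈ Ω, HasFDerivAt (fun p => F p - dx F p₀ * p.2.1)
      (0 : ℝ × ℝ × ℝ →L[ℝ] ℝ) p := by
    intro p hp
    have h1 : HasFDerivAt (fun p : ℝ × ℝ × ℝ => p.2.1)
        ((ContinuousLinearMap.fst ℝ ℝ ℝ).comp (ContinuousLinearMap.snd ℝ ℝ (ℝ × ℝ))) p :=
      hasFDerivAt_fst.comp p hasFDerivAt_snd
    refine ((hasFDerivAt_of_mem hΩ hF hp).sub (h1.const_mul (dx F p₀))).congr_fderiv ?_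
    refine ContinuousLinearMap.ext fun ⟨a, b, c⟩ => ?_
    simp [fderiv_triple, ht _ hp, hu _ hp, hx _ hp]
  have := hΩ.is_const_of_fderiv_eq_zero (𝕜 := ℝ) hcon
    (fun y hy => (hder y hy).differentiableAt.differentiableWithinAt)
    (fun y hy => (hder y hy).fderiv) hp h₀
  linarith

/-- The third derivative of `x ↦ F (t, x, q(x))` for a parabola `q` depends affinely on the second
derivative `2 b` of `q`. -/
lemma iteratedDeriv_three_parabola (hΩ : IsOpen Ω) (hF : ContDiffOn ℝ ∞ F Ω) {t x u : ℝ}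
    (hp : (t, x, u) ∈ Ω) (a b : ℝ) :
    iteratedDeriv 3 (fun y => F (t, y, u + a * (y - x) + b * (y - x) ^ 2)) x =
      dx (dx (dx F)) (t, x, u) + du (dx (dx F)) (t, x, u) * a
      + (dx (du (dx F)) (t, x, u) + du (du (dx F)) (t, x, u) * a) * a
      + (dx (dx (du F)) (t, x, u) + du (dx (du F)) (t, x, u) * a
        + (dx (du (du F)) (t, x, u) + du (du (du F)) (t, x, u) * a) * a) * a
      + 2 * b * (3 * dx (du F) (t, x, u) + 3 * a * du (du F) (t, x, u)) := by
  set q : ℝ → ℝ := fun y => u + a * (y - x) + b * (y - x) ^ 2 with hq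
  have hqx : q x = u := by simp [hq]
  have hq1 : ∀ y, HasDerivAt q (a + 2 * b * (y - x)) y := fun y => by
    have h := ((hasDerivAt_id y).sub_const x)
    have := ((h.const_mul a).const_add u).add ((h.pow 2).const_mul b)
    refine this.congr_deriv ?_
    simp; ring
  have hq2 : ∀ y, HasDerivAt (fun y => a + 2 * b * (y - x)) (2 * b) y := fun y => by
    have h := ((hasDerivAt_id y).sub_const x)
    simpa using (h.const_mul (2 * b)).const_add a
  have hch : ∀ {G : ℝ × ℝ × ℝ → ℝ}, ContDiffOn ℝ ∞ G Ω → ∀ {y}, (t, y, q y) ∈ Ω →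
      HasDerivAt (fun y => G (t, y, q y))
        (dx G (t, y, q y) + du G (t, y, q y) * (a + 2 * b * (y - x))) y := by
    intro G hG y hy
    have := hasDerivAt_comp_curve hΩ hG (a := fun _ => t) (b := fun y => y) (c := q)
      (s := y) hy (hasDerivAt_const _ _) (hasDerivAt_id _) (hq1 y)
    simpa using this
  have hev : ∀ᶠ y in 𝓝 x, (t, y, q y) ∈ Ω := by
    have : ContinuousAt (fun y => (t, y, q y)) x := by fun_prop
    exact this.eventually_mem (hΩ.mem_nhds (by simpa [hqx] using hp))
  have hFx := contDiffOn_dx hΩ hF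
  have hFu := contDiffOn_du hΩ hF
  have e1 : deriv (fun y => F (t, y, q y)) =ᶠ[𝓝 x]
      fun y => dx F (t, y, q y) + du F (t, y, q y) * (a + 2 * b * (y - x)) := by
    filter_upwards [hev] with y hy using (hch hF hy).deriv
  have e2 : deriv (deriv (fun y => F (t, y, q y))) =ᶠ[𝓝 x]
      fun y => dx (dx F) (t, y, q y) + du (dx F) (t, y, q y) * (a + 2 * b * (y - x))
        + ((dx (du F) (t, y, q y) + du (du F) (t, y, q y) * (a + 2 * b * (y - x)))
            * (a + 2 * b * (y - x)) + du F (t, y, q y) * (2 * b)) := by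
    filter_upwards [hev, e1.eventuallyEq_nhds] with y hy he
    rw [he.deriv_eq]
    exact ((hch hFx hy).add ((hch hFu hy).mul (hq2 y))).deriv
  rw [iteratedDeriv_succ, iteratedDeriv_succ, iteratedDeriv_one, e2.deriv_eq]
  have hpx : (t, x, q x) ∈ Ω := by rwa [hqx]
  have h1 := hch (contDiffOn_dx hΩ hFx) hpx
  have h2 := hch (contDiffOn_du hΩ hFx) hpx
  have h3 := hch (contDiffOn_dx hΩ hFu) hpx
  have h4 := hch (contDiffOn_du hΩ hFu) hpx
  have h5 := hch hFu hpx
  have := ((h1.add (h2.mul (hq2 x))).add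
    (((h3.add (h4.mul (hq2 x))).mul (hq2 x)).add (h5.mul_const (2 * b)))).deriv
  refine Eq.trans this ?_
  simp only [hqx, sub_self, mul_zero, add_zero, Pi.mul_apply, Pi.add_apply,
    dx_du_comm hΩ hF hp]
  ring

lemma du_dt_comm (hΩ : IsOpen Ω) (hF : ContDiffOn ℝ ∞ F Ω) {p : ℝ × ℝ × ℝ} (hp : p ∈ Ω) :
    du (dt F) p = dt (du F) p := fderiv_fderiv_comm hΩ hF hp _ _

lemma fderiv_eq_zero_of_eq_zero (hΩ : IsOpen Ω) (hF : ∀ p ∈ Ω, F p = 0) {p : ℝ × ℝ × ℝ}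
    (hp : p ∈ Ω) : fderiv ℝ F p = 0 := by
  have : F =ᶠ[𝓝 p] fun _ => 0 := Filter.eventually_of_mem (hΩ.mem_nhds hp) hF
  rw [this.fderiv_eq, fderiv_fun_const]
  rfl

lemma dt_eq_zero_of_eq_zero (hΩ : IsOpen Ω) (hF : ∀ p ∈ Ω, F p = 0) {p : ℝ × ℝ × ℝ}
    (hp : p ∈ Ω) : dt F p = 0 := by simp [dt, fderiv_eq_zero_of_eq_zero hΩ hF hp]

lemma dx_eq_zero_of_eq_zero (hΩ : IsOpen Ω) (hF : ∀ p ∈ Ω, F p = 0) {p : ℝ × ℝ × ℝ}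
    (hp : p ∈ Ω) : dx F p = 0 := by simp [dx, fderiv_eq_zero_of_eq_zero hΩ hF hp]

lemma du_eq_zero_of_eq_zero (hΩ : IsOpen Ω) (hF : ∀ p ∈ Ω, F p = 0) {p : ℝ × ℝ × ℝ}
    (hp : p ∈ Ω) : du F p = 0 := by simp [du, fderiv_eq_zero_of_eq_zero hΩ hF hp]

lemma hasDerivAt_line_x (hΩ : IsOpen Ω) (hF : ContDiffOn ℝ ∞ F Ω) {t x u : ℝ}
    (hp : (t, x, u) ∈ Ω) : HasDerivAt (fun y => F (t, y, u)) (dx F (t, x, u)) x := by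
  simpa using hasDerivAt_comp_curve hΩ hF (a := fun _ => t) (b := fun y => y) (c := fun _ => u)
    hp (hasDerivAt_const _ _) (hasDerivAt_id _) (hasDerivAt_const _ _)

lemma hasDerivAt_line_u (hΩ : IsOpen Ω) (hF : ContDiffOn ℝ ∞ F Ω) {t x u : ℝ}
    (hp : (t, x, u) ∈ Ω) : HasDerivAt (fun w => F (t, x, w)) (du F (t, x, u)) u := by
  simpa using hasDerivAt_comp_curve hΩ hF (a := fun _ => t) (b := fun _ => x) (c := fun w => w)
    hp (hasDerivAt_const _ _) (hasDerivAt_const _ _) (hasDerivAt_id _)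

lemma eventually_mem_line_x (hΩ : IsOpen Ω) {t x u : ℝ} (hp : (t, x, u) ∈ Ω) :
    ∀ᶠ y in 𝓝 x, (t, y, u) ∈ Ω :=
  (show ContinuousAt (fun y : ℝ => (t, y, u)) x by fun_prop).eventually_mem (hΩ.mem_nhds hp)

lemma eventually_mem_line_u (hΩ : IsOpen Ω) {t x u : ℝ} (hp : (t, x, u) ∈ Ω) :
    ∀ᶠ w in 𝓝 u, (t, x, w) ∈ Ω :=
  (show ContinuousAt (fun w : ℝ => (t, x, w)) u by fun_prop).eventually_mem (hΩ.mem_nhds hp)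

lemma dx_eq_zero_of_section (hΩ : IsOpen Ω) (hF : ContDiffOn ℝ ∞ F Ω)
    (h : ∀ p ∈ Ω, ∀ q ∈ Ω, p.1 = q.1 → F p = F q) {p : ℝ × ℝ × ℝ} (hp : p ∈ Ω) : dx F p = 0 := by
  obtain ⟨t, x, u⟩ := p
  refine (hasDerivAt_line_x hΩ hF hp).unique
    ((hasDerivAt_const x (F (t, x, u))).congr_of_eventuallyEq ?_)
  filter_upwards [eventually_mem_line_x hΩ hp] with y hy
  exact h _ hy _ hp rfl

end Smooth

/-! ### The transformations of the stated form are equivalence transformations -/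

lemma iteratedDeriv_comp_affine (f : ℝ → ℝ) (c d : ℝ) (k : ℕ) :
    iteratedDeriv k (fun y => f (c * y + d)) = fun y => c ^ k * iteratedDeriv k f (c * y + d) := by
  induction k with
  | zero => simp
  | succ k ih =>
    rw [iteratedDeriv_succ, ih, iteratedDeriv_succ]
    funext y
    rw [deriv_const_mul_field, deriv_comp_mul_left c (fun w => iteratedDeriv k f (w + d)),
      deriv_comp_add_const, smul_eq_mul]
    ring

lemma isOpen_image_fst {Ω : Set (ℝ × ℝ × ℝ)} (hΩ : IsOpen Ω) : IsOpen (Prod.fst '' Ω) :=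
  isOpenMap_fst Ω hΩ

section Diagonal

variable {Ω : Set (ℝ × ℝ × ℝ)} {Φ : ℝ × ℝ × ℝ → ℝ × ℝ × ℝ} {τ τ' θ : ℝ → ℝ} {ε₁ ε₀ : ℝ}

lemma contDiffOn_comp_fst {Ω : Set (ℝ × ℝ × ℝ)} {f : ℝ → ℝ}
    (hf : ContDiffOn ℝ ∞ f (Prod.fst '' Ω)) : ContDiffOn ℝ ∞ (fun p : ℝ × ℝ × ℝ => f p.1) Ω :=
  hf.comp contDiffOn_fst fun _ hp => ⟨_, hp, rfl⟩

lemma contDiffOn_diagonal (hτ : ContDiffOn ℝ ∞ τ (Prod.fst '' Ω))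
    (hθ : ContDiffOn ℝ ∞ θ (Prod.fst '' Ω))
    (hΦ : ∀ p ∈ Ω, Φ p = (τ p.1, ε₁ * p.2.1 + ε₀, θ p.1 * p.2.2)) : ContDiffOn ℝ ∞ Φ Ω := by
  refine ContDiffOn.congr ?_ hΦ
  refine (contDiffOn_comp_fst hτ).prodMk (ContDiffOn.prodMk ?_ ?_)
  · exact ContDiff.contDiffOn (by fun_prop)
  · exact (contDiffOn_comp_fst hθ).mul (ContDiff.contDiffOn (by fun_prop))

lemma det_fderiv_diagonal_ne_zero (hΩ : IsOpen Ω) (hθ : ContDiffOn ℝ ∞ θ (Prod.fst '' Ω))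
    (hΦ : ∀ p ∈ Ω, Φ p = (τ p.1, ε₁ * p.2.1 + ε₀, θ p.1 * p.2.2)) (hε : ε₁ ≠ 0)
    (hτ : ∀ t ∈ Prod.fst '' Ω, HasDerivAt τ (τ' t) t) (hτ0 : ∀ t ∈ Prod.fst '' Ω, τ' t ≠ 0)
    (hθ0 : ∀ t ∈ Prod.fst '' Ω, θ t ≠ 0) {p : ℝ × ℝ × ℝ} (hp : p ∈ Ω) :
    (fderiv ℝ Φ p).det ≠ 0 := by
  have hI : p.1 ∈ Prod.fst '' Ω := ⟨p, hp, rfl⟩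
  have hθd : HasDerivAt θ (deriv θ p.1) p.1 :=
    (((hθ _ hI).contDiffAt ((isOpen_image_fst hΩ).mem_nhds hI)).differentiableAt
      (by simp)).hasDerivAt
  have hf : HasFDerivAt (fun p : ℝ × ℝ × ℝ => p.1) (ContinuousLinearMap.fst ℝ ℝ (ℝ × ℝ)) p :=
    hasFDerivAt_fst
  have hs : HasFDerivAt (fun p : ℝ × ℝ × ℝ => p.2) (ContinuousLinearMap.snd ℝ ℝ (ℝ × ℝ)) p :=
    hasFDerivAt_snd
  have h1 := (hτ _ hI).comp_hasFDerivAt p hf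
  have h2 := ((hasFDerivAt_fst.comp p hs).const_mul ε₁).add_const ε₀
  have h3 := (hθd.comp_hasFDerivAt p hf).mul (hasFDerivAt_snd.comp p hs)
  have h := (h1.prodMk (h2.prodMk h3)).congr_of_eventuallyEq (f₁ := Φ)
    (Filter.eventually_of_mem (hΩ.mem_nhds hp) hΦ)
  rw [h.fderiv]
  apply det_ne_zero_of_injective
  rintro ⟨a, b, c⟩ h0
  simp only [ContinuousLinearMap.prod_apply, Prod.mk_eq_zero] at h0
  obtain ⟨ha, hb, hc⟩ := h0
  have ha' : a = 0 := by simpa [hτ0 _ hI] using ha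
  have hb' : b = 0 := by simpa [hε] using hb
  subst ha' hb'
  have hc' : c = 0 := by simpa [hθ0 _ hI] using hc
  rw [hc']
  rfl

/-- The chain rule for the prolongation: a diagonal transformation multiplies the left-hand side of
the equation by `θ ^ (n + 1) / ε₁`. -/
lemma holdsAt_iff_of_diagonal {E E' : Equation} (hΩ : IsOpen Ω) (hn : E'.n = E.n)
    (hθs : ContDiffOn ℝ ∞ θ (Prod.fst '' Ω))
    (hΦ : ∀ p ∈ Ω, Φ p = (τ p.1, ε₁ * p.2.1 + ε₀, θ p.1 * p.2.2)) (hε : ε₁ ≠ 0)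
    (hθ : ∀ t ∈ Prod.fst '' Ω, θ t ≠ 0 ∧ θ t ∈ powDomain E.n)
    (hτ : ∀ t ∈ Prod.fst '' Ω, HasDerivAt τ (ε₁ * θ t ^ (-E.n)) t)
    (hg : ∀ t ∈ Prod.fst '' Ω, E'.g (τ t) = ε₁ ^ 2 * θ t ^ E.n * E.g t)
    (hh : ∀ t ∈ Prod.fst '' Ω, E'.h (τ t) = θ t ^ E.n / ε₁ * (E.h t - deriv θ t / θ t))
    (hpow : ∀ p ∈ Ω, p.2.2 ∈ powDomain E.n)
    {v v' : ℝ × ℝ → ℝ} {z : ℝ × ℝ} (hz : (z.1, z.2, v z) ∈ Ω) (hv : ContDiffAt ℝ ∞ v z)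
    (hv' : ContDiffAt ℝ ∞ v' (baseMap Φ v z))
    (he : ∀ᶠ w in 𝓝 z, v' (baseMap Φ v w) = (Φ (w.1, w.2, v w)).2.2) :
    E.HoldsAt v z ↔ E'.HoldsAt v' (baseMap Φ v z) := by
  obtain ⟨t, x⟩ := z
  have hI : t ∈ Prod.fst '' Ω := ⟨_, hz, rfl⟩
  obtain ⟨hθ0, hθp⟩ := hθ t hI
  have hmem : ∀ᶠ w in 𝓝 (t, x), (w.1, w.2, v w) ∈ Ω := by
    have : ContinuousAt (fun w : ℝ × ℝ => (w.1, w.2, v w)) (t, x) :=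
      continuousAt_fst.prodMk (continuousAt_snd.prodMk hv.continuousAt)
    exact this.eventually_mem (hΩ.mem_nhds hz)
  have he2 : ∀ᶠ w in 𝓝 (t, x), v' (τ w.1, ε₁ * w.2 + ε₀) = θ w.1 * v w := by
    filter_upwards [he, hmem] with w h1 h2
    simpa [baseMap, hΦ _ h2] using h1
  have hb : baseMap Φ v (t, x) = (τ t, ε₁ * x + ε₀) := by
    simp [baseMap, hΦ _ hz]
  rw [hb] at hv' ⊢
  have h0 : v' (τ t, ε₁ * x + ε₀) = θ t * v (t, x) := he2.self_of_nhds
  have hxl : (fun y => v' (τ t, ε₁ * y + ε₀)) =ᶠ[𝓝 x] fun y => θ t * v (t, y) :=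
    (show Tendsto (fun y : ℝ => (t, y)) (𝓝 x) (𝓝 (t, x)) from
      (by fun_prop : Continuous fun y : ℝ => (t, y)).tendsto x).eventually he2
  have htl : (fun s => v' (τ s, ε₁ * x + ε₀)) =ᶠ[𝓝 t] fun s => θ s * v (s, x) :=
    (show Tendsto (fun s : ℝ => (s, x)) (𝓝 t) (𝓝 (t, x)) from
      (by fun_prop : Continuous fun s : ℝ => (s, x)).tendsto t).eventually he2
  have hx1 := hxl.iteratedDeriv_eq 1
  have hx3 := hxl.iteratedDeriv_eq 3
  rw [iteratedDeriv_comp_affine (fun y => v' (τ t, y)), iteratedDeriv_const_mul_field] at hx1 hx3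
  rw [iteratedDeriv_one, iteratedDeriv_one, pow_one] at hx1
  have hθd : HasDerivAt θ (deriv θ t) t :=
    (((hθs _ hI).contDiffAt ((isOpen_image_fst hΩ).mem_nhds hI)).differentiableAt
      (by simp)).hasDerivAt
  have hvt : DifferentiableAt ℝ (fun s => v (s, x)) t :=
    (hv.differentiableAt (by simp)).comp t (by fun_prop : DifferentiableAt ℝ (fun s => (s, x)) t)
  have hvt' : DifferentiableAt ℝ (fun s => v' (s, ε₁ * x + ε₀)) (τ t) :=
    (hv'.differentiableAt (by simp)).comp (τ t)
      (by fun_prop : DifferentiableAt ℝ (fun s => (s, ε₁ * x + ε₀)) (τ t))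
  have ht1 := htl.deriv_eq
  have d1 : HasDerivAt (fun s => v' (τ s, ε₁ * x + ε₀))
      (deriv (fun s => v' (s, ε₁ * x + ε₀)) (τ t) * (ε₁ * θ t ^ (-E.n))) t :=
    hvt'.hasDerivAt.comp t (hτ t hI)
  have d2 : HasDerivAt (fun s => θ s * v (s, x))
      (deriv θ t * v (t, x) + θ t * deriv (fun s => v (s, x)) t) t := hθd.mul hvt.hasDerivAt
  rw [d1.deriv, d2.deriv, rpow_neg_of_mem hθp] at ht1
  have hK := rpow_ne_zero_of_mem hθp hθ0
  unfold Equation.HoldsAt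
  simp only [hn, h0, hg t hI, hh t hI, mul_rpow_of_mem hθp (hpow _ hz)] at *
  set K := θ t ^ E.n
  set q1 := deriv (fun s => v' (s, ε₁ * x + ε₀)) (τ t)
  set q2 := deriv (fun y => v' (τ t, y)) (ε₁ * x + ε₀)
  set q3 := iteratedDeriv 3 (fun y => v' (τ t, y)) (ε₁ * x + ε₀)
  set r1 := deriv (fun s => v (s, x)) t
  set r2 := deriv (fun y => v (t, y)) x
  set r3 := iteratedDeriv 3 (fun y => v (t, y)) x
  have e1 : q1 = K / ε₁ * (deriv θ t * v (t, x) + θ t * r1) := by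
    field_simp at ht1 ⊢
    linarith
  have e2 : q2 = θ t * r2 / ε₁ := by field_simp; linarith
  have e3 : q3 = θ t * r3 / ε₁ ^ 3 := by field_simp; linarith
  have key : q1 + K * v (t, x) ^ E.n * q2
      + K / ε₁ * (E.h t - deriv θ t / θ t) * (θ t * v (t, x)) + ε₁ ^ 2 * K * E.g t * q3
      = K * θ t / ε₁ * (r1 + v (t, x) ^ E.n * r2 + E.h t * v (t, x) + E.g t * r3) := by
    rw [e1, e2, e3]
    field_simp
    ring
  rw [key, mul_eq_zero]
  constructor
  · exact Or.inr
  · rintro (h | h)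
    · exact absurd h (div_ne_zero (mul_ne_zero hK hθ0) hε)
    · exact h

end Diagonal

section Form

variable {n : ℝ} {Ω : Set (ℝ × ℝ × ℝ)} {t₀ ε₀ ε₁ ε₂ : ℝ} {θ : ℝ → ℝ} {𝒯 : ExtMap}

lemma HasForm.contDiffOn_rpow (H : HasForm n Ω t₀ ε₀ ε₁ ε₂ θ 𝒯) (m : ℝ) :
    ContDiffOn ℝ ∞ (fun t => θ t ^ m) (Prod.fst '' Ω) :=
  GKdV.contDiffOn_rpow H.θ_smooth (fun t ht => (H.θ_ne t ht).1) m

lemma HasForm.hasDerivAt_time (H : HasForm n Ω t₀ ε₀ ε₁ ε₂ θ 𝒯) (hΩ : IsOpen Ω)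
    (hI : (Prod.fst '' Ω).OrdConnected) (h₀ : t₀ ∈ Prod.fst '' Ω) {t : ℝ}
    (ht : t ∈ Prod.fst '' Ω) :
    HasDerivAt (fun t => ε₁ * (∫ s in t₀..t, θ s ^ (-n)) + ε₂) (ε₁ * θ t ^ (-n)) t :=
  ((hasDerivAt_integral (isOpen_image_fst hΩ) hI (H.contDiffOn_rpow _).continuousOn h₀
    ht).const_mul ε₁).add_const ε₂

lemma HasForm.Φ_eq (H : HasForm n Ω t₀ ε₀ ε₁ ε₂ θ 𝒯) {p : ℝ × ℝ × ℝ} (hp : p ∈ Ω) :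
    𝒯.Φ p = ((fun t => ε₁ * (∫ s in t₀..t, θ s ^ (-n)) + ε₂) p.1, ε₁ * p.2.1 + ε₀,
      θ p.1 * p.2.2) :=
  Prod.ext (H.t_eq p hp) (Prod.ext (H.x_eq p hp) (H.u_eq p hp))

/-- A transformation of the stated form takes every equation with the exponent `n` to an equation
of the class, which may be chosen with the image interval as its domain. -/
lemma HasForm.exists_target (H : HasForm n Ω t₀ ε₀ ε₁ ε₂ θ 𝒯) (hΩ : IsOpen Ω)
    (hI : (Prod.fst '' Ω).OrdConnected) (h₀ : t₀ ∈ Prod.fst '' Ω)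
    (hpow : ∀ p ∈ Ω, p.2.2 ∈ powDomain n) {E : Equation} (hE : E.n = n)
    (hEI : Prod.fst '' Ω ⊆ E.I) :
    ∃ E' : Equation, 𝒯.Takes Ω E E' ∧ Connects Ω E E' 𝒯.Φ ∧
      E'.I ⊆ (fun p => (𝒯.Φ p).1) '' Ω := by
  subst hE
  set I := Prod.fst '' Ω with hIdef
  have hIo : IsOpen I := isOpen_image_fst hΩ
  set τ : ℝ → ℝ := fun t => ε₁ * (∫ s in t₀..t, θ s ^ (-E.n)) + ε₂ with hτdef
  have hΦ : ∀ p ∈ Ω, 𝒯.Φ p = (τ p.1, ε₁ * p.2.1 + ε₀, θ p.1 * p.2.2) := fun p hp => H.Φ_eq hp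
  have hτ : ∀ t ∈ I, HasDerivAt τ (ε₁ * θ t ^ (-E.n)) t := fun t ht =>
    H.hasDerivAt_time hΩ hI h₀ ht
  have hτ0 : ∀ t ∈ I, ε₁ * θ t ^ (-E.n) ≠ 0 := fun t ht => by
    rw [rpow_neg_of_mem (H.θ_ne t ht).2]
    exact mul_ne_zero H.ε₁_ne (inv_ne_zero (rpow_ne_zero_of_mem (H.θ_ne t ht).2 (H.θ_ne t ht).1))
  have hτs : ContDiffOn ℝ ∞ τ I :=
    contDiffOn_of_hasDerivAt hIo (contDiffOn_const.mul (H.contDiffOn_rpow _)) hτ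
  obtain ⟨hJo, hJc, σ, hσs, hσ⟩ := exists_smooth_inverse hIo hI hτs hτ hτ0
  have hσm : Set.MapsTo σ (τ '' I) I := by
    rintro _ ⟨t, ht, rfl⟩
    rwa [hσ t ht]
  have hθ' : ContDiffOn ℝ ∞ (deriv θ) I :=
    ((contDiffOn_infty_iff_deriv_of_isOpen hIo).mp H.θ_smooth).2
  have hKs := H.contDiffOn_rpow E.n
  let E' : Equation :=
    { n := E.n
      I := τ '' I
      g := fun s => ε₁ ^ 2 * θ (σ s) ^ E.n * E.g (σ s)
      h := fun s => θ (σ s) ^ E.n / ε₁ * (E.h (σ s) - deriv θ (σ s) / θ (σ s))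
      n_ne := E.n_ne
      isOpen_I := hJo
      ordConnected_I := hJc
      nonempty_I := ⟨_, _, h₀, rfl⟩
      g_smooth := (contDiffOn_const.mul (hKs.comp hσs hσm)).mul
        ((E.g_smooth.mono hEI).comp hσs hσm)
      h_smooth := ((hKs.div_const ε₁).mul ((E.h_smooth.mono hEI).sub
        (hθ'.div H.θ_smooth fun t ht => (H.θ_ne t ht).1))).comp hσs hσm
      g_ne := by
        rintro _ ⟨t, ht, rfl⟩
        rw [hσ t ht]
        exact mul_ne_zero (mul_ne_zero (pow_ne_zero _ H.ε₁_ne)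
          (rpow_ne_zero_of_mem (H.θ_ne t ht).2 (H.θ_ne t ht).1)) (E.g_ne t (hEI ht)) }
  have hg : ∀ t ∈ I, E'.g (τ t) = ε₁ ^ 2 * θ t ^ E.n * E.g t := fun t ht => by
    simp only [E', hσ t ht]
  have hh : ∀ t ∈ I, E'.h (τ t) = θ t ^ E.n / ε₁ * (E.h t - deriv θ t / θ t) := fun t ht => by
    simp only [E', hσ t ht]
  refine ⟨E', fun p hp => ?_, ?_, ?_⟩
  · have hpI : p.1 ∈ I := ⟨p, hp, rfl⟩
    have hg0 := E.g_ne _ (hEI hpI)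
    rw [H.n_eq p hp _ _ hg0, H.g_eq p hp _ _ hg0, H.h_eq p hp _ _ hg0, hΦ p hp]
    exact ⟨hEI hpI, ⟨_, hpI, rfl⟩, rfl, hg _ hpI, hh _ hpI⟩
  · refine ⟨hΩ, contDiffOn_diagonal hτs H.θ_smooth hΦ, fun p hp =>
      det_fderiv_diagonal_ne_zero hΩ H.θ_smooth hΦ H.ε₁_ne hτ hτ0 (fun t ht => (H.θ_ne t ht).1) hp,
      fun p hp => ⟨hEI ⟨p, hp, rfl⟩, hpow p hp⟩, fun p hp => ?_, ?_⟩
    · have hpI : p.1 ∈ I := ⟨p, hp, rfl⟩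
      rw [hΦ p hp]
      exact ⟨⟨_, hpI, rfl⟩, mul_mem_powDomain (H.θ_ne _ hpI).2 (H.θ_ne _ hpI).1 (hpow p hp)⟩
    · intro v v' z hz hv hv' _ he
      exact holdsAt_iff_of_diagonal (E := E) (E' := E') hΩ rfl H.θ_smooth hΦ H.ε₁_ne H.θ_ne hτ hg
        hh hpow hz hv hv' he
  · rintro _ ⟨_, ⟨p, hp, rfl⟩, rfl⟩
    exact ⟨p, hp, by simp only [hΦ p hp]⟩

lemma HasForm.isEquivalence (H : HasForm n Ω t₀ ε₀ ε₁ ε₂ θ 𝒯) (hΩ : IsOpen Ω)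
    (hI : (Prod.fst '' Ω).OrdConnected) (h₀ : t₀ ∈ Prod.fst '' Ω)
    (hpow : ∀ p ∈ Ω, p.2.2 ∈ powDomain n) : IsEquivalence n Ω 𝒯 := by
  have hIo : IsOpen (Prod.fst '' Ω) := isOpen_image_fst hΩ
  set τ : ℝ → ℝ := fun t => ε₁ * (∫ s in t₀..t, θ s ^ (-n)) + ε₂ with hτdef
  have hΦ : ∀ p ∈ Ω, 𝒯.Φ p = (τ p.1, ε₁ * p.2.1 + ε₀, θ p.1 * p.2.2) := fun p hp => H.Φ_eq hp
  have hτ : ∀ t ∈ Prod.fst '' Ω, HasDerivAt τ (ε₁ * θ t ^ (-n)) t := fun t ht =>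
    H.hasDerivAt_time hΩ hI h₀ ht
  have hK0 : ∀ t ∈ Prod.fst '' Ω, θ t ^ n ≠ 0 := fun t ht =>
    rpow_ne_zero_of_mem (H.θ_ne t ht).2 (H.θ_ne t ht).1
  have hτ0 : ∀ t ∈ Prod.fst '' Ω, ε₁ * θ t ^ (-n) ≠ 0 := fun t ht => by
    rw [rpow_neg_of_mem (H.θ_ne t ht).2]
    exact mul_ne_zero H.ε₁_ne (inv_ne_zero (hK0 t ht))
  have hτs : ContDiffOn ℝ ∞ τ (Prod.fst '' Ω) :=
    contDiffOn_of_hasDerivAt hIo (contDiffOn_const.mul (H.contDiffOn_rpow _)) hτ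
  have hΦs := contDiffOn_diagonal hτs H.θ_smooth hΦ
  have hθ' : ContDiffOn ℝ ∞ (deriv θ) (Prod.fst '' Ω) :=
    ((contDiffOn_infty_iff_deriv_of_isOpen hIo).mp H.θ_smooth).2
  set A : Set (ℝ × ℝ) := {a : ℝ × ℝ | a.1 ≠ 0} with hA
  have hAo : IsOpen A := isOpen_ne.preimage continuous_fst
  have hsm : ContDiffOn ℝ ∞ 𝒯.toFun (Ω ×ˢ A) := by
    have hfst : Set.MapsTo (fun q : (ℝ × ℝ × ℝ) × ℝ × ℝ => q.1.1) (Ω ×ˢ A) (Prod.fst '' Ω) :=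
      fun q hq => ⟨q.1, hq.1, rfl⟩
    have hc : ∀ f : ℝ → ℝ, ContDiffOn ℝ ∞ f (Prod.fst '' Ω) →
        ContDiffOn ℝ ∞ (fun q : (ℝ × ℝ × ℝ) × ℝ × ℝ => f q.1.1) (Ω ×ˢ A) := fun f hf =>
      hf.comp (ContDiff.contDiffOn (by fun_prop)) hfst
    refine ContDiffOn.prodMk (hΦs.comp contDiffOn_fst fun q hq => hq.1)
      (ContDiffOn.prodMk ?_ ?_)
    · refine ContDiffOn.congr (f := fun q => ε₁ ^ 2 * θ q.1.1 ^ n * q.2.1) ?_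
        (fun q hq => H.g_eq q.1 hq.1 _ _ hq.2)
      exact (contDiffOn_const.mul (hc _ (H.contDiffOn_rpow n))).mul
        (ContDiff.contDiffOn (by fun_prop))
    · refine ContDiffOn.congr
        (f := fun q => θ q.1.1 ^ n / ε₁ * (q.2.2 - deriv θ q.1.1 / θ q.1.1)) ?_
        (fun q hq => H.h_eq q.1 hq.1 _ _ hq.2)
      exact ((hc _ (H.contDiffOn_rpow n)).div_const _).mul
        (ContDiffOn.sub (ContDiff.contDiffOn (by fun_prop))
          ((hc _ hθ').div (hc _ H.θ_smooth) fun q hq => (H.θ_ne _ (hfst hq)).1))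
  refine ⟨hΩ, hsm, ?_, fun E hE hEI => ?_⟩
  · intro q hq
    have hqI : q.1.1 ∈ Prod.fst '' Ω := ⟨q.1, hq.1, rfl⟩
    have hd : HasFDerivAt 𝒯.toFun (fderiv ℝ 𝒯.toFun q) q :=
      (((hsm q hq).contDiffAt ((hΩ.prod hAo).mem_nhds hq)).differentiableAt (by simp)).hasFDerivAt
    apply det_ne_zero_of_injective
    rintro ⟨w, a, b⟩ h0
    -- The projection to the variables has an injective derivative, so `w = 0`.
    have hΦd : HasFDerivAt 𝒯.Φ (fderiv ℝ 𝒯.Φ q.1) q.1 :=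
      (((hΦs q.1 hq.1).contDiffAt (hΩ.mem_nhds hq.1)).differentiableAt (by simp)).hasFDerivAt
    have h1 : HasFDerivAt (fun q => 𝒯.Φ q.1) ((fderiv ℝ 𝒯.Φ q.1).comp
        (ContinuousLinearMap.fst ℝ (ℝ × ℝ × ℝ) (ℝ × ℝ))) q := hΦd.comp q hasFDerivAt_fst
    have h2 : HasFDerivAt (fun q => 𝒯.Φ q.1) ((ContinuousLinearMap.fst ℝ (ℝ × ℝ × ℝ) (ℝ × ℝ)).comp
        (fderiv ℝ 𝒯.toFun q)) q := hd.fst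
    have h3 := congrArg (fun L => L (w, a, b)) (h1.unique h2)
    simp only [ContinuousLinearMap.comp_apply, ContinuousLinearMap.coe_fst', h0,
      Prod.fst_zero] at h3
    have hw : w = 0 := by
      have hdet := det_fderiv_diagonal_ne_zero hΩ H.θ_smooth hΦ H.ε₁_ne hτ hτ0
        (fun t ht => (H.θ_ne t ht).1) hq.1
      rw [← (ContinuousLinearMap.toContinuousLinearEquivOfDetNeZero _ hdet).map_eq_zero_iff]
      exact h3
    subst hw
    -- On the line through `q` in the direction `(0, a, b)` the coefficients are affine.
    have hl : HasDerivAt (fun s : ℝ => q + s • (((0 : ℝ × ℝ × ℝ), a, b) : (ℝ × ℝ × ℝ) × ℝ × ℝ))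
        (((0 : ℝ × ℝ × ℝ), a, b) : (ℝ × ℝ × ℝ) × ℝ × ℝ) 0 := by
      simpa using ((hasDerivAt_id (0 : ℝ)).smul_const
        (((0 : ℝ × ℝ × ℝ), a, b) : (ℝ × ℝ × ℝ) × ℝ × ℝ)).const_add q
    have h4 := hd.comp_hasDerivAt_of_eq (0 : ℝ) hl (by simp)
    rw [h0] at h4
    have hev : ∀ᶠ s : ℝ in 𝓝 0, q.2.1 + s * a ≠ 0 := by
      have : ContinuousAt (fun s : ℝ => q.2.1 + s * a) 0 := by fun_prop
      exact this.eventually_ne (by simpa using hq.2)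
    have hfun : (𝒯.toFun ∘ fun s : ℝ => q + s • (((0 : ℝ × ℝ × ℝ), a, b) : (ℝ × ℝ × ℝ) × ℝ × ℝ))
        =ᶠ[𝓝 0] fun s => (𝒯.Φ q.1, ε₁ ^ 2 * θ q.1.1 ^ n * (q.2.1 + s * a),
          θ q.1.1 ^ n / ε₁ * (q.2.2 + s * b - deriv θ q.1.1 / θ q.1.1)) := by
      filter_upwards [hev] with s hs
      simp [ExtMap.toFun, H.g_eq q.1 hq.1 _ _ hs, H.h_eq q.1 hq.1 _ _ hs]
    have hs1 : ∀ c d : ℝ, HasDerivAt (fun s : ℝ => c + s * d) d 0 := fun c d => by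
      simpa using ((hasDerivAt_id (0 : ℝ)).mul_const d).const_add c
    have h5 : HasDerivAt (fun s => (𝒯.Φ q.1, ε₁ ^ 2 * θ q.1.1 ^ n * (q.2.1 + s * a),
          θ q.1.1 ^ n / ε₁ * (q.2.2 + s * b - deriv θ q.1.1 / θ q.1.1)))
        (0, ε₁ ^ 2 * θ q.1.1 ^ n * a, θ q.1.1 ^ n / ε₁ * b) (0 : ℝ) :=
      (hasDerivAt_const _ _).prodMk (((hs1 _ a).const_mul _).prodMk
        (((hs1 _ b).sub_const _).const_mul _))
    have h6 := (h4.congr_of_eventuallyEq hfun.symm).unique h5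
    have hK := hK0 _ hqI
    have hε := H.ε₁_ne
    simp only [Prod.ext_iff, Prod.snd_zero, Prod.fst_zero] at h6
    have ha : a = 0 := by simpa [hK, hε] using h6.2.1.symm
    have hb : b = 0 := by simpa [hK, hε] using h6.2.2.symm
    rw [ha, hb]
    rfl
  · obtain ⟨E', h1, h2, -⟩ := H.exists_target hΩ hI h₀ hpow hE hEI
    exact ⟨E', h1, h2⟩

end Form

/-! ### Prolongation of point transformations -/

lemma deriv_fst_eq_fderiv {v : ℝ × ℝ → ℝ} {z : ℝ × ℝ} (hv : DifferentiableAt ℝ v z) :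
    deriv (fun t => v (t, z.2)) z.1 = fderiv ℝ v z (1, 0) := by
  have h : HasDerivAt (fun t => (t, z.2)) ((1, 0) : ℝ × ℝ) z.1 :=
    (hasDerivAt_id z.1).prodMk (hasDerivAt_const z.1 z.2)
  exact (hv.hasFDerivAt.comp_hasDerivAt z.1 h).deriv

lemma deriv_snd_eq_fderiv {v : ℝ × ℝ → ℝ} {z : ℝ × ℝ} (hv : DifferentiableAt ℝ v z) :
    deriv (fun x => v (z.1, x)) z.2 = fderiv ℝ v z (0, 1) := by
  have h : HasDerivAt (fun x => (z.1, x)) ((0, 1) : ℝ × ℝ) z.2 :=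
    (hasDerivAt_const z.2 z.1).prodMk (hasDerivAt_id z.2)
  exact (hv.hasFDerivAt.comp_hasDerivAt z.2 h).deriv

lemma Equation.holdsAt_iff {E : Equation} {v : ℝ × ℝ → ℝ} {z : ℝ × ℝ}
    (hv : DifferentiableAt ℝ v z) :
    E.HoldsAt v z ↔ fderiv ℝ v z (1, 0) + v z ^ E.n * fderiv ℝ v z (0, 1) + E.h z.1 * v z
      + E.g z.1 * iteratedDeriv 3 (fun x => v (z.1, x)) z.2 = 0 := by
  rw [Equation.HoldsAt, deriv_fst_eq_fderiv hv, deriv_snd_eq_fderiv hv]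

/-- The polynomials in `(t, x)`, centred at `z`, that represent the jets used below. -/
def jetPoly (z : ℝ × ℝ) (u m a b c k : ℝ) (w : ℝ × ℝ) : ℝ :=
  u + m * (w.1 - z.1) + a * (w.2 - z.2) + b * (w.2 - z.2) ^ 2 + c * (w.2 - z.2) ^ 3
    + k * (w.1 - z.1) ^ 3

section JetPoly
variable (z : ℝ × ℝ) (u m a b c k : ℝ)

@[simp] lemma jetPoly_self : jetPoly z u m a b c k z = u := by simp [jetPoly]

lemma contDiff_jetPoly : ContDiff ℝ ∞ (jetPoly z u m a b c k) := by
  unfold jetPoly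
  fun_prop

lemma differentiable_jetPoly : Differentiable ℝ (jetPoly z u m a b c k) :=
  (contDiff_jetPoly z u m a b c k).differentiable (by simp)

@[simp] lemma fderiv_jetPoly_fst : fderiv ℝ (jetPoly z u m a b c k) z (1, 0) = m := by
  rw [← deriv_fst_eq_fderiv (differentiable_jetPoly z u m a b c k z)]
  have h := (hasDerivAt_id z.1).sub_const z.1
  have h2 := ((h.const_mul m).const_add u).add ((h.pow 3).const_mul k)
  simp only [id, sub_self] at h2
  refine HasDerivAt.deriv ((h2.congr_deriv (by simp)).congr_of_eventuallyEq (.of_forall fun s => ?_))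
  simp [jetPoly]

lemma iteratedDeriv_jetPoly_snd (i : ℕ) :
    iteratedDeriv i (fun x => jetPoly z u m a b c k (z.1, x)) z.2 =
      iteratedDeriv i (fun x => u + a * x + b * x ^ 2 + c * x ^ 3) 0 := by
  have := iteratedDeriv_comp_affine (fun x => u + a * x + b * x ^ 2 + c * x ^ 3) 1 (-z.2) i
  have h2 := congrFun this z.2
  simp only [one_pow, one_mul, add_neg_cancel] at h2
  rw [← h2]
  congr 1
  funext x
  simp [jetPoly, sub_eq_add_neg]

lemma deriv_cubic (u a b c : ℝ) : deriv (fun x : ℝ => u + a * x + b * x ^ 2 + c * x ^ 3) =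
    fun x => a + (2 * b) * x + (3 * c) * x ^ 2 + 0 * x ^ 3 := by
  funext x
  have h := hasDerivAt_id x
  have := (((h.const_mul a).const_add u).add ((h.pow 2).const_mul b)).add ((h.pow 3).const_mul c)
  refine Eq.trans this.deriv ?_
  simp
  ring

@[simp] lemma fderiv_jetPoly_snd : fderiv ℝ (jetPoly z u m a b c k) z (0, 1) = a := by
  rw [← deriv_snd_eq_fderiv (differentiable_jetPoly z u m a b c k z)]
  have := iteratedDeriv_jetPoly_snd z u m a b c k 1
  rw [iteratedDeriv_one, iteratedDeriv_one, deriv_cubic] at this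
  simpa using this

@[simp] lemma iteratedDeriv_three_jetPoly :
    iteratedDeriv 3 (fun x => jetPoly z u m a b c k (z.1, x)) z.2 = 6 * c := by
  rw [iteratedDeriv_jetPoly_snd, iteratedDeriv_succ, iteratedDeriv_succ, iteratedDeriv_one,
    deriv_cubic, deriv_cubic, deriv_cubic]
  ring

lemma holdsAt_jetPoly_iff {E : Equation} :
    E.HoldsAt (jetPoly z u m a b c k) z ↔
      m + u ^ E.n * a + E.h z.1 * u + E.g z.1 * (6 * c) = 0 := by
  rw [Equation.holdsAt_iff (differentiable_jetPoly z u m a b c k z)]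
  simp

end JetPoly

/-- The inverse function theorem in the plane. -/
lemma exists_local_inverse {B : ℝ × ℝ → ℝ × ℝ} {z : ℝ × ℝ} (hB : ContDiffAt ℝ ∞ B z)
    (hd : (fderiv ℝ B z).det ≠ 0) :
    ∃ γ : ℝ × ℝ → ℝ × ℝ, ContDiffAt ℝ ∞ γ (B z) ∧ γ (B z) = z ∧ (∀ᶠ y in 𝓝 (B z), B (γ y) = y) ∧
      ∀ᶠ w in 𝓝 z, γ (B w) = w := by
  set e := (fderiv ℝ B z).toContinuousLinearEquivOfDetNeZero hd
  have he : HasFDerivAt B (e : ℝ × ℝ →L[ℝ] ℝ × ℝ) z := by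
    rw [ContinuousLinearMap.coe_toContinuousLinearEquivOfDetNeZero]
    exact (hB.differentiableAt (by simp)).hasFDerivAt
  have hst := hB.hasStrictFDerivAt' he (by simp)
  exact ⟨hB.localInverse he (by simp), hB.to_localInverse he (by simp),
    hB.localInverse_apply_image he (by simp), hst.eventually_right_inverse,
    hst.eventually_left_inverse⟩

section Prolongation

variable {Ω : Set (ℝ × ℝ × ℝ)} {T X U : ℝ × ℝ × ℝ → ℝ} {v v' : ℝ × ℝ → ℝ} {z : ℝ × ℝ}

/-- The Jacobian of the map `(t, x) ↦ (T, X)(t, x, v(t, x))` at a point `p` of the graph of `v`, as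
a function of the first derivatives `m`, `a` of `v`. -/
noncomputable def baseJacobian (T X : ℝ × ℝ × ℝ → ℝ) (p : ℝ × ℝ × ℝ) (m a : ℝ) : ℝ :=
  (dt T p + du T p * m) * (dx X p + du X p * a) - (dx T p + du T p * a) * (dt X p + du X p * m)

lemma fderiv_comp_graph_apply {F : ℝ × ℝ × ℝ → ℝ} (hΩ : IsOpen Ω) (hF : ContDiffOn ℝ ∞ F Ω)
    (hz : (z.1, z.2, v z) ∈ Ω) (hv : DifferentiableAt ℝ v z) (a b : ℝ) :
    fderiv ℝ (fun w : ℝ × ℝ => F (w.1, w.2, v w)) z (a, b) =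
      (dt F (z.1, z.2, v z) + du F (z.1, z.2, v z) * fderiv ℝ v z (1, 0)) * a
        + (dx F (z.1, z.2, v z) + du F (z.1, z.2, v z) * fderiv ℝ v z (0, 1)) * b := by
  rw [(fderiv_comp_graph hΩ hF hz hv).fderiv]
  simp only [ContinuousLinearMap.comp_apply, ContinuousLinearMap.prod_apply,
    ContinuousLinearMap.coe_fst', ContinuousLinearMap.coe_snd', fderiv_triple, fderiv_pair v z a b]
  ring

lemma contDiffAt_comp_graph {F : ℝ × ℝ × ℝ → ℝ} (hΩ : IsOpen Ω) (hF : ContDiffOn ℝ ∞ F Ω)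
    (hz : (z.1, z.2, v z) ∈ Ω) (hv : ContDiffAt ℝ ∞ v z) :
    ContDiffAt ℝ ∞ (fun w : ℝ × ℝ => F (w.1, w.2, v w)) z :=
  (contDiffAt_of_mem hΩ hF hz).comp z (contDiffAt_fst.prodMk (contDiffAt_snd.prodMk hv))

lemma contDiffAt_baseMap (hΩ : IsOpen Ω) (hT : ContDiffOn ℝ ∞ T Ω) (hX : ContDiffOn ℝ ∞ X Ω)
    (hz : (z.1, z.2, v z) ∈ Ω) (hv : ContDiffAt ℝ ∞ v z) :
    ContDiffAt ℝ ∞ (baseMap (fun p => (T p, X p, U p)) v) z :=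
  (contDiffAt_comp_graph hΩ hT hz hv).prodMk (contDiffAt_comp_graph hΩ hX hz hv)

lemma fderiv_baseMap_apply (hΩ : IsOpen Ω) (hT : ContDiffOn ℝ ∞ T Ω) (hX : ContDiffOn ℝ ∞ X Ω)
    (hz : (z.1, z.2, v z) ∈ Ω) (hv : ContDiffAt ℝ ∞ v z) (w : ℝ × ℝ) :
    fderiv ℝ (baseMap (fun p => (T p, X p, U p)) v) z w =
      (fderiv ℝ (fun w : ℝ × ℝ => T (w.1, w.2, v w)) z w,
        fderiv ℝ (fun w : ℝ × ℝ => X (w.1, w.2, v w)) z w) := by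
  have h1 := (contDiffAt_comp_graph hΩ hT hz hv).differentiableAt (by simp)
  have h2 := (contDiffAt_comp_graph hΩ hX hz hv).differentiableAt (by simp)
  have h : HasFDerivAt (baseMap (fun p => (T p, X p, U p)) v) _ z :=
    h1.hasFDerivAt.prodMk h2.hasFDerivAt
  rw [h.fderiv]
  rfl

lemma det_fderiv_baseMap_ne_zero (hΩ : IsOpen Ω) (hT : ContDiffOn ℝ ∞ T Ω)
    (hX : ContDiffOn ℝ ∞ X Ω) (hz : (z.1, z.2, v z) ∈ Ω) (hv : ContDiffAt ℝ ∞ v z)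
    (hJ : baseJacobian T X (z.1, z.2, v z) (fderiv ℝ v z (1, 0)) (fderiv ℝ v z (0, 1)) ≠ 0) :
    (fderiv ℝ (baseMap (fun p => (T p, X p, U p)) v) z).det ≠ 0 := by
  have hvd : DifferentiableAt ℝ v z := hv.differentiableAt (by simp)
  apply det_ne_zero_of_injective
  rintro ⟨a, b⟩ h0
  rw [fderiv_baseMap_apply hΩ hT hX hz hv, fderiv_comp_graph_apply hΩ hT hz hvd,
    fderiv_comp_graph_apply hΩ hX hz hvd, Prod.mk_eq_zero] at h0
  obtain ⟨h1, h2⟩ := h0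
  unfold baseJacobian at hJ
  have ha : a = 0 := by
    refine (mul_eq_zero.mp ?_).resolve_left hJ
    linear_combination (dx X (z.1, z.2, v z) + du X (z.1, z.2, v z) * fderiv ℝ v z (0, 1)) * h1
      - (dx T (z.1, z.2, v z) + du T (z.1, z.2, v z) * fderiv ℝ v z (0, 1)) * h2
  have hb : b = 0 := by
    refine (mul_eq_zero.mp ?_).resolve_left hJ
    linear_combination (dt T (z.1, z.2, v z) + du T (z.1, z.2, v z) * fderiv ℝ v z (1, 0)) * h2
      - (dt X (z.1, z.2, v z) + du X (z.1, z.2, v z) * fderiv ℝ v z (1, 0)) * h1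
  rw [ha, hb]
  rfl

/-- The first derivatives of the image `v'` of `v`, given implicitly. -/
lemma prolongation_first_order (hΩ : IsOpen Ω) (hT : ContDiffOn ℝ ∞ T Ω)
    (hX : ContDiffOn ℝ ∞ X Ω) (hU : ContDiffOn ℝ ∞ U Ω) (hz : (z.1, z.2, v z) ∈ Ω)
    (hv : ContDiffAt ℝ ∞ v z)
    (hv' : DifferentiableAt ℝ v' (T (z.1, z.2, v z), X (z.1, z.2, v z)))
    (he : ∀ᶠ w in 𝓝 z, v' (T (w.1, w.2, v w), X (w.1, w.2, v w)) = U (w.1, w.2, v w))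
    {p : ℝ × ℝ × ℝ} (hp : p = (z.1, z.2, v z)) {m a q₁ q₂ : ℝ}
    (hm : fderiv ℝ v z (1, 0) = m) (ha : fderiv ℝ v z (0, 1) = a)
    (hq₁ : fderiv ℝ v' (T p, X p) (1, 0) = q₁) (hq₂ : fderiv ℝ v' (T p, X p) (0, 1) = q₂) :
    q₁ * (dt T p + du T p * m) + q₂ * (dt X p + du X p * m) = dt U p + du U p * m ∧
    q₁ * (dx T p + du T p * a) + q₂ * (dx X p + du X p * a) = dx U p + du U p * a := by
  subst hp hm ha hq₁ hq₂
  have hvd : DifferentiableAt ℝ v z := hv.differentiableAt (by simp)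
  have h1 := ((contDiffAt_comp_graph hΩ hT hz hv).differentiableAt (by simp)).hasFDerivAt
  have h2 := ((contDiffAt_comp_graph hΩ hX hz hv).differentiableAt (by simp)).hasFDerivAt
  have h3 := ((contDiffAt_comp_graph hΩ hU hz hv).differentiableAt (by simp)).hasFDerivAt
  have h4 := hv'.hasFDerivAt.comp z (h1.prodMk h2)
  have h5 := h4.unique (h3.congr_of_eventuallyEq he)
  have key : ∀ a b, _ := fun a b => congrArg (fun L => L (a, b)) h5
  simp only [ContinuousLinearMap.comp_apply, ContinuousLinearMap.prod_apply,
    fderiv_comp_graph_apply hΩ hT hz hvd, fderiv_comp_graph_apply hΩ hX hz hvd,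
    fderiv_comp_graph_apply hΩ hU hz hvd] at key
  have k1 := key 1 0
  have k2 := key 0 1
  rw [fderiv_pair] at k1 k2
  constructor
  · linear_combination k1
  · linear_combination k2

/-- Two functions with contact at `z`, compared along the curve `γ` that the first one maps to the
line `t̃ = const`. If they differ by `κ s ^ 3` to third order, then so do their images, up to the
factor `U_u - v'_t̃ T_u - v'_x̃ X_u`. -/
lemma prolongation_contact (hΩ : IsOpen Ω) (hT : ContDiffOn ℝ ∞ T Ω)
    (hX : ContDiffOn ℝ ∞ X Ω) (hU : ContDiffOn ℝ ∞ U Ω) {p : ℝ × ℝ × ℝ} (hp : p ∈ Ω)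
    {v₁ v₂ v₁' v₂' : ℝ × ℝ → ℝ} {z : ℝ × ℝ} (hv₁ : ContinuousAt v₁ z) (hv₂ : ContinuousAt v₂ z)
    (hp₁ : (z.1, z.2, v₁ z) = p) (hp₂ : (z.1, z.2, v₂ z) = p)
    (hv₁' : ContDiffAt ℝ ∞ v₁' (T p, X p)) (hv₂' : ContDiffAt ℝ ∞ v₂' (T p, X p))
    (he₁ : ∀ᶠ w in 𝓝 z, v₁' (T (w.1, w.2, v₁ w), X (w.1, w.2, v₁ w)) = U (w.1, w.2, v₁ w))
    (he₂ : ∀ᶠ w in 𝓝 z, v₂' (T (w.1, w.2, v₂ w), X (w.1, w.2, v₂ w)) = U (w.1, w.2, v₂ w))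
    {γ : ℝ → ℝ × ℝ} (hγ : ContinuousAt γ 0) (hγ0 : γ 0 = z)
    (hγT : ∀ᶠ s in 𝓝 0, T ((γ s).1, (γ s).2, v₁ (γ s)) = T p)
    (hγX : ∀ᶠ s in 𝓝 0, X ((γ s).1, (γ s).2, v₁ (γ s)) = X p + s)
    {κ : ℝ} (hκ : Tendsto (fun s => (v₂ (γ s) - v₁ (γ s)) / s ^ 3) (𝓝[≠] 0) (𝓝 κ)) :
    v₂' (T p, X p) = v₁' (T p, X p) ∧
    fderiv ℝ v₂' (T p, X p) (0, 1) = fderiv ℝ v₁' (T p, X p) (0, 1) ∧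
    iteratedDeriv 3 (fun y => v₂' (T p, y)) (X p) - iteratedDeriv 3 (fun y => v₁' (T p, y)) (X p)
      = 6 * ((du U p - fderiv ℝ v₂' (T p, X p) (1, 0) * du T p
          - fderiv ℝ v₂' (T p, X p) (0, 1) * du X p) * κ) := by
  set c := du U p - fderiv ℝ v₂' (T p, X p) (1, 0) * du T p
          - fderiv ℝ v₂' (T p, X p) (0, 1) * du X p with hc
  set D : ℝ → ℝ := fun s => v₂' (T p, X p + s) - v₁' (T p, X p + s) with hDdef
  have hline : ∀ {f : ℝ × ℝ → ℝ}, ContDiffAt ℝ ∞ f (T p, X p) →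
      ContDiffAt ℝ ∞ (fun s => f (T p, X p + s)) 0 := fun {f} hf =>
    ContDiffAt.comp (0 : ℝ) (g := f) (f := fun s => (T p, X p + s)) (by simpa using hf)
      (contDiffAt_const.prodMk (contDiffAt_const.add contDiffAt_id))
  have hD : ContDiffAt ℝ ∞ D 0 := (hline hv₂').sub (hline hv₁')
  -- The defect of a point from the graph of `v₂'`.
  set K : ℝ × ℝ × ℝ → ℝ := fun q => U q - v₂' (T q, X q) with hK
  have hKs : ContDiffAt ℝ ∞ K p := (contDiffAt_of_mem hΩ hU hp).sub
    (hv₂'.comp p ((contDiffAt_of_mem hΩ hT hp).prodMk (contDiffAt_of_mem hΩ hX hp)))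
  have hKd : HasStrictFDerivAt K (fderiv ℝ K p) p := hKs.hasStrictFDerivAt (by simp)
  have hKc : ∀ r, fderiv ℝ K p (0, 0, r) = c * r := by
    intro r
    have h := (hasFDerivAt_of_mem hΩ hU hp).sub
      ((hv₂'.differentiableAt (by simp)).hasFDerivAt.comp p
        ((hasFDerivAt_of_mem hΩ hT hp).prodMk (hasFDerivAt_of_mem hΩ hX hp)))
    have h' : HasFDerivAt K _ p := h
    rw [h'.fderiv]
    simp only [sub_apply, ContinuousLinearMap.comp_apply,
      ContinuousLinearMap.prod_apply, fderiv_triple, mul_zero, zero_add, hc]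
    rw [fderiv_pair]
    ring
  have hγt : Tendsto γ (𝓝 0) (𝓝 z) := by simpa [ContinuousAt, hγ0] using hγ
  have hP : ∀ {w : ℝ × ℝ → ℝ}, ContinuousAt w z → (z.1, z.2, w z) = p →
      Tendsto (fun s => ((γ s).1, (γ s).2, w (γ s))) (𝓝 0) (𝓝 p) := by
    intro w hw hwp
    rw [← hwp]
    have : ContinuousAt (fun y : ℝ × ℝ => (y.1, y.2, w y)) z :=
      continuousAt_fst.prodMk (continuousAt_snd.prodMk hw)
    exact this.tendsto.comp hγt
  have hO := hKd.isLittleO.comp_tendsto ((hP hv₂ hp₂).prodMk_nhds (hP hv₁ hp₁))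
  have hO' : (fun s => D s - c * (v₂ (γ s) - v₁ (γ s))) =o[𝓝 0] fun s => v₂ (γ s) - v₁ (γ s) := by
    refine Asymptotics.IsLittleO.congr' (hO.trans_isBigO ?_) ?_ (EventuallyEq.refl _ _)
      (g₁ := fun s => v₂ (γ s) - v₁ (γ s))
    · refine Asymptotics.IsBigO.of_bound 1 (Eventually.of_forall fun s => ?_)
      simp [Prod.norm_def]
    · filter_upwards [hγT, hγX, hγt.eventually he₁, hγt.eventually he₂] with s h1 h2 h3 h4
      have e1 : K ((γ s).1, (γ s).2, v₂ (γ s)) = 0 := by simp only [hK, h4, sub_self]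
      have e2 : K ((γ s).1, (γ s).2, v₁ (γ s)) = - D s := by
        simp only [hK, hDdef, ← h3, h1, h2]
        ring
      have e3 : (((γ s).1, (γ s).2, v₂ (γ s)) : ℝ × ℝ × ℝ) - ((γ s).1, (γ s).2, v₁ (γ s))
          = (0, 0, v₂ (γ s) - v₁ (γ s)) := by simp
      simp only [Function.comp_apply, e1, e2, e3, hKc]
      ring
  have hlim : Tendsto (fun s => D s / s ^ 3) (𝓝[≠] 0) (𝓝 (c * κ)) := by
    have hne : ∀ᶠ s : ℝ in 𝓝[≠] 0, s ^ 3 ≠ 0 := by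
      filter_upwards [eventually_mem_nhdsWithin] with s hs using pow_ne_zero _ hs
    have hb : (fun s => v₂ (γ s) - v₁ (γ s)) =O[𝓝[≠] 0] fun s : ℝ => s ^ 3 :=
      Asymptotics.isBigO_of_div_tendsto_nhds
        (hne.mono fun s hs h => absurd h hs) κ hκ
    have h1 := ((hO'.mono nhdsWithin_le_nhds).trans_isBigO hb).tendsto_div_nhds_zero
    have h2 := h1.add (hκ.const_mul c)
    rw [zero_add] at h2
    refine h2.congr fun s => ?_
    ring
  obtain ⟨h0, h1, h3⟩ := derivs_of_tendsto_div_pow_three hD hlim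
  refine ⟨by simpa [hDdef, sub_eq_zero] using h0, ?_, ?_⟩
  · have hd2 := (hline hv₂').differentiableAt (by simp)
    have hd1 := (hline hv₁').differentiableAt (by simp)
    have h1' : deriv D 0 = _ := deriv_sub hd2 hd1
    rw [deriv_comp_const_add (fun y => v₂' (T p, y)), deriv_comp_const_add (fun y => v₁' (T p, y)),
      h1, add_zero] at h1'
    rw [← deriv_snd_eq_fderiv (hv₂'.differentiableAt (by simp)),
      ← deriv_snd_eq_fderiv (hv₁'.differentiableAt (by simp))]
    linarith
  · have hd2 : ContDiffAt ℝ 3 _ _ := mod_cast contDiffAt_infty.mp (hline hv₂') 3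
    have hd1 : ContDiffAt ℝ 3 _ _ := mod_cast contDiffAt_infty.mp (hline hv₁') 3
    have h3' : iteratedDeriv 3 D 0 = _ := iteratedDeriv_sub hd2 hd1
    rw [iteratedDeriv_comp_const_add 3 (fun y => v₂' (T p, y)),
      iteratedDeriv_comp_const_add 3 (fun y => v₁' (T p, y)), h3] at h3'
    simpa using h3'.symm

end Prolongation

/-! ### The determining equations -/

section Necessary

variable {Ω : Set (ℝ × ℝ × ℝ)} {E E' : Equation} {T X U : ℝ × ℝ × ℝ → ℝ}

lemma Connects.smooth_T (hC : Connects Ω E E' fun p => (T p, X p, U p)) : ContDiffOn ℝ ∞ T Ω :=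
  contDiff_fst.comp_contDiffOn hC.smooth

lemma Connects.smooth_X (hC : Connects Ω E E' fun p => (T p, X p, U p)) : ContDiffOn ℝ ∞ X Ω :=
  contDiff_fst.comp_contDiffOn (contDiff_snd.comp_contDiffOn hC.smooth)

lemma Connects.smooth_U (hC : Connects Ω E E' fun p => (T p, X p, U p)) : ContDiffOn ℝ ∞ U Ω :=
  contDiff_snd.comp_contDiffOn (contDiff_snd.comp_contDiffOn hC.smooth)

/-- The Jacobi matrix of `(T, X, U)` is surjective. -/
lemma Connects.exists_solve (hC : Connects Ω E E' fun p => (T p, X p, U p)) {p : ℝ × ℝ × ℝ}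
    (hp : p ∈ Ω) (α β γ : ℝ) : ∃ a b c, dt T p * a + dx T p * b + du T p * c = α ∧
      dt X p * a + dx X p * b + du X p * c = β ∧ dt U p * a + dx U p * b + du U p * c = γ := by
  obtain ⟨⟨a, b, c⟩, h⟩ := exists_eq_of_det_ne_zero _ (hC.jacobian_ne p hp) (α, β, γ)
  have hd : HasFDerivAt (fun p => (T p, X p, U p)) _ p :=
    (hasFDerivAt_of_mem hC.isOpen hC.smooth_T hp).prodMk
      ((hasFDerivAt_of_mem hC.isOpen hC.smooth_X hp).prodMk
        (hasFDerivAt_of_mem hC.isOpen hC.smooth_U hp))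
  rw [hd.fderiv] at h
  simp only [ContinuousLinearMap.prod_apply, Prod.mk.injEq, fderiv_triple] at h
  exact ⟨a, b, c, h⟩

/-- Every jet on the first equation at which the prolongation is defined has an image on the
second. -/
lemma Connects.exists_image (hC : Connects Ω E E' fun p => (T p, X p, U p)) {t x u : ℝ}
    (hp : (t, x, u) ∈ Ω) {m a c : ℝ} (b k : ℝ) (hJ : baseJacobian T X (t, x, u) m a ≠ 0)
    (hE : m + u ^ E.n * a + E.h t * u + E.g t * (6 * c) = 0) :
    ∃ v' : ℝ × ℝ → ℝ, ContDiffAt ℝ ∞ v' (T (t, x, u), X (t, x, u)) ∧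
      (∀ᶠ w in 𝓝 (t, x), v' (T (w.1, w.2, jetPoly (t, x) u m a b c k w),
        X (w.1, w.2, jetPoly (t, x) u m a b c k w))
          = U (w.1, w.2, jetPoly (t, x) u m a b c k w)) ∧
      fderiv ℝ v' (T (t, x, u), X (t, x, u)) (1, 0)
        + U (t, x, u) ^ E'.n * fderiv ℝ v' (T (t, x, u), X (t, x, u)) (0, 1)
        + E'.h (T (t, x, u)) * U (t, x, u)
        + E'.g (T (t, x, u)) * iteratedDeriv 3 (fun y => v' (T (t, x, u), y)) (X (t, x, u)) = 0 ∧
      fderiv ℝ v' (T (t, x, u), X (t, x, u)) (1, 0) * (dt T (t, x, u) + du T (t, x, u) * m)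
        + fderiv ℝ v' (T (t, x, u), X (t, x, u)) (0, 1) * (dt X (t, x, u) + du X (t, x, u) * m)
        = dt U (t, x, u) + du U (t, x, u) * m ∧
      fderiv ℝ v' (T (t, x, u), X (t, x, u)) (1, 0) * (dx T (t, x, u) + du T (t, x, u) * a)
        + fderiv ℝ v' (T (t, x, u), X (t, x, u)) (0, 1) * (dx X (t, x, u) + du X (t, x, u) * a)
        = dx U (t, x, u) + du U (t, x, u) * a := by
  set v := jetPoly (t, x) u m a b c k with hvdef
  have hvz : v (t, x) = u := jetPoly_self _ _ _ _ _ _ _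
  have hv : ContDiffAt ℝ ∞ v (t, x) := (contDiff_jetPoly _ _ _ _ _ _ _).contDiffAt
  have hz : ((t, x).1, (t, x).2, v (t, x)) ∈ Ω := by rw [hvz]; exact hp
  have hdet := det_fderiv_baseMap_ne_zero (U := U) hC.isOpen hC.smooth_T hC.smooth_X hz hv
    (by simpa [hvdef] using hJ)
  obtain ⟨γ, hγs, hγz, -, hγ⟩ := exists_local_inverse
    (contDiffAt_baseMap (U := U) hC.isOpen hC.smooth_T hC.smooth_X hz hv) hdet
  have hbz : baseMap (fun p => (T p, X p, U p)) v (t, x) = (T (t, x, u), X (t, x, u)) := by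
    simp [baseMap, hvz]
  set v' : ℝ × ℝ → ℝ := fun y => U ((γ y).1, (γ y).2, v (γ y)) with hv'def
  have hv's : ContDiffAt ℝ ∞ v' (baseMap (fun p => (T p, X p, U p)) v (t, x)) := by
    have h1 := contDiffAt_comp_graph hC.isOpen hC.smooth_U hz hv
    rw [← hγz] at h1
    exact h1.comp _ hγs
  have hev : ∀ᶠ w in 𝓝 (t, x), v' (baseMap (fun p => (T p, X p, U p)) v w)
      = U (w.1, w.2, v w) := by
    filter_upwards [hγ] with w hw
    simp only [hv'def, hw]
  have h := (hC.jets v v' (t, x) hz hv hv's hdet hev).mp ((holdsAt_jetPoly_iff _ _ _ _ _ _ _).mpr hE)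
  rw [Equation.holdsAt_iff (hv's.differentiableAt (by simp)), hev.self_of_nhds, hbz] at h
  rw [hbz] at hv's
  refine ⟨v', hv's, hev, by simpa [hvz] using h, ?_⟩
  exact prolongation_first_order hC.isOpen hC.smooth_T hC.smooth_X hC.smooth_U hz hv
    (by simpa [hvz] using hv's.differentiableAt (by simp)) hev (by simp [hvz])
    (fderiv_jetPoly_fst _ _ _ _ _ _ _) (fderiv_jetPoly_snd _ _ _ _ _ _ _) rfl rfl

/-- The factor that an increment of `u` acquires under a point transformation does not vanish. -/
lemma Connects.characteristic_ne_zero (hC : Connects Ω E E' fun p => (T p, X p, U p))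
    {p : ℝ × ℝ × ℝ} (hp : p ∈ Ω) {m a q₁ q₂ : ℝ}
    (h₁ : q₁ * (dt T p + du T p * m) + q₂ * (dt X p + du X p * m) = dt U p + du U p * m)
    (h₂ : q₁ * (dx T p + du T p * a) + q₂ * (dx X p + du X p * a) = dx U p + du U p * a) :
    du U p - q₁ * du T p - q₂ * du X p ≠ 0 := by
  intro h0
  obtain ⟨r, s, w, e1, e2, e3⟩ := hC.exists_solve hp 0 0 1
  have : (1 : ℝ) = 0 := by
    linear_combination q₁ * e1 + q₂ * e2 - e3 - r * h₁ - s * h₂ + (w - r * m - s * a) * h0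
  exact one_ne_zero this

/-- The preimage under `(T, X)`, restricted to a graph, of the line `t̃ = const`. -/
lemma exists_contact_curve (hΩ : IsOpen Ω) (hT : ContDiffOn ℝ ∞ T Ω)
    (hX : ContDiffOn ℝ ∞ X Ω) {v : ℝ × ℝ → ℝ} {z : ℝ × ℝ} {p : ℝ × ℝ × ℝ}
    (hz : (z.1, z.2, v z) = p) (hp : p ∈ Ω)
    (hv : ContDiffAt ℝ ∞ v z) {m a : ℝ} (hm : fderiv ℝ v z (1, 0) = m)
    (ha : fderiv ℝ v z (0, 1) = a) (hJ : baseJacobian T X p m a ≠ 0) :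
    ∃ (γ : ℝ → ℝ × ℝ) (r₁ r₂ : ℝ), γ 0 = z ∧ HasDerivAt γ (r₁, r₂) 0 ∧
      (∀ᶠ s in 𝓝 0, T ((γ s).1, (γ s).2, v (γ s)) = T p) ∧
      (∀ᶠ s in 𝓝 0, X ((γ s).1, (γ s).2, v (γ s)) = X p + s) ∧
      (dt T p + du T p * m) * r₁ + (dx T p + du T p * a) * r₂ = 0 ∧
      (dt X p + du X p * m) * r₁ + (dx X p + du X p * a) * r₂ = 1 := by
  subst hz hm ha
  have hvd : DifferentiableAt ℝ v z := hv.differentiableAt (by simp)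
  -- The third component of the transformation is irrelevant for `baseMap`.
  set B := baseMap (fun p => (T p, X p, T p)) v with hB
  have hBs : ContDiffAt ℝ ∞ B z := contDiffAt_baseMap hΩ hT hX hp hv
  obtain ⟨γ, hγs, hγz, hγ, -⟩ := exists_local_inverse hBs
    (det_fderiv_baseMap_ne_zero hΩ hT hX hp hv hJ)
  have hl : HasDerivAt (fun s : ℝ => B z + s • ((0, 1) : ℝ × ℝ)) ((0, 1) : ℝ × ℝ) 0 := by
    simpa using ((hasDerivAt_id (0 : ℝ)).smul_const ((0, 1) : ℝ × ℝ)).const_add (B z)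
  have hd := (hγs.differentiableAt (by simp)).hasFDerivAt.comp_hasDerivAt_of_eq (0 : ℝ) hl (by simp)
  set r := fderiv ℝ γ (B z) (0, 1) with hr
  have hev : ∀ᶠ s : ℝ in 𝓝 0, B (γ (B z + s • (0, 1))) = B z + s • (0, 1) := by
    have : Tendsto (fun s : ℝ => B z + s • ((0, 1) : ℝ × ℝ)) (𝓝 0) (𝓝 (B z)) := by
      simpa using hl.continuousAt.tendsto
    exact this.eventually hγ
  have hBγ : HasDerivAt (fun s : ℝ => B (γ (B z + s • (0, 1)))) (fderiv ℝ B z r) 0 :=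
    (hBs.differentiableAt (by simp)).hasFDerivAt.comp_hasDerivAt_of_eq (0 : ℝ) hd (by simp [hγz])
  have h1 := hBγ.unique (hl.congr_of_eventuallyEq hev)
  rw [hB, fderiv_baseMap_apply hΩ hT hX hp hv, show r = (r.1, r.2) from rfl,
    fderiv_comp_graph_apply hΩ hT hp hvd, fderiv_comp_graph_apply hΩ hX hp hvd] at h1
  refine ⟨fun s => γ (B z + s • (0, 1)), r.1, r.2, by simp [hγz], hd, ?_, ?_,
    congrArg Prod.fst h1, congrArg Prod.snd h1⟩
  · filter_upwards [hev] with s hs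
    simpa [hB, baseMap] using congrArg Prod.fst hs
  · filter_upwards [hev] with s hs
    simpa [hB, baseMap] using congrArg Prod.snd hs

lemma tendsto_sub_pow_three_div {f : ℝ → ℝ} {r c : ℝ} (hf : HasDerivAt f r 0) (h0 : f 0 = c) :
    Tendsto (fun s => (f s - c) ^ 3 / s ^ 3) (𝓝[≠] 0) (𝓝 (r ^ 3)) := by
  have h := hf.tendsto_slope_zero.pow 3
  refine h.congr fun s => ?_
  simp only [zero_add, h0, smul_eq_mul]
  rw [mul_pow, inv_pow]
  ring

/-- The third derivative of `v` in `t`, which is free in the first equation, enters the second one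
with the factor `(T_x + T_u v_x) ^ 3`, so this factor vanishes. -/
lemma Connects.total_dx_T_eq_zero (hC : Connects Ω E E' fun p => (T p, X p, U p)) {p : ℝ × ℝ × ℝ}
    (hp : p ∈ Ω) {m a : ℝ} (hJ : baseJacobian T X p m a ≠ 0) : dx T p + du T p * a = 0 := by
  obtain ⟨t, x, u⟩ := p
  have hI : t ∈ E.I := (hC.source hp).1
  have hI' : T (t, x, u) ∈ E'.I := (hC.target hp).1
  have hg : E.g t ≠ 0 := E.g_ne t hI
  obtain ⟨c, hE⟩ : ∃ c, m + u ^ E.n * a + E.h t * u + E.g t * (6 * c) = 0 :=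
    ⟨-(m + u ^ E.n * a + E.h t * u) / (6 * E.g t), by field_simp; ring⟩
  obtain ⟨v₁', hs₁, he₁, hE₁, f1, f2⟩ := hC.exists_image hp 0 0 hJ hE
  obtain ⟨v₂', hs₂, he₂, hE₂, f3, f4⟩ := hC.exists_image hp 0 1 hJ hE
  obtain ⟨γ, r₁, r₂, hγ0, hγ, hγT, hγX, hr₁, hr₂⟩ := exists_contact_curve hC.isOpen hC.smooth_T
    hC.smooth_X (v := jetPoly (t, x) u m a 0 c 0) (z := (t, x)) (p := (t, x, u)) (by simp) hp
    (contDiff_jetPoly _ _ _ _ _ _ _).contDiffAt (fderiv_jetPoly_fst _ _ _ _ _ _ _)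
    (fderiv_jetPoly_snd _ _ _ _ _ _ _) hJ
  have hκ : Tendsto (fun s => (jetPoly (t, x) u m a 0 c 1 (γ s) - jetPoly (t, x) u m a 0 c 0 (γ s))
      / s ^ 3) (𝓝[≠] 0) (𝓝 (r₁ ^ 3)) := by
    have hγ1 : HasDerivAt (fun s => (γ s).1) r₁ 0 := hγ.fst
    refine (tendsto_sub_pow_three_div hγ1 (c := t) (by simp [hγ0])).congr fun s => ?_
    simp [jetPoly]
  obtain ⟨-, hx, h3⟩ := prolongation_contact hC.isOpen hC.smooth_T hC.smooth_X hC.smooth_U hp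
    (z := (t, x)) (contDiff_jetPoly _ _ _ _ _ _ _).continuous.continuousAt
    (contDiff_jetPoly _ _ _ _ _ _ _).continuous.continuousAt (by simp) (by simp) hs₁ hs₂ he₁ he₂
    hγ.continuousAt hγ0 hγT hγX hκ
  have hne := hC.characteristic_ne_zero hp f3 f4
  unfold baseJacobian at hJ
  set q₁ := fderiv ℝ v₁' (T (t, x, u), X (t, x, u)) (1, 0)
  set q₂ := fderiv ℝ v₂' (T (t, x, u), X (t, x, u)) (1, 0)
  rw [hx] at f3 f4 hE₂ h3 hne
  -- The first-order jets of the two images agree, as those of the two functions do.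
  have hq : q₂ = q₁ := by
    have e1 : (q₂ - q₁) * (dt T (t, x, u) + du T (t, x, u) * m) = 0 := by
      linear_combination f3 - f1
    have e2 : (q₂ - q₁) * (dx T (t, x, u) + du T (t, x, u) * a) = 0 := by
      linear_combination f4 - f2
    have : (q₂ - q₁) = 0 := by
      refine (mul_eq_zero.mp ?_).resolve_right hJ
      linear_combination (dx X (t, x, u) + du X (t, x, u) * a) * e1
        - (dt X (t, x, u) + du X (t, x, u) * m) * e2
    linarith
  have hr : r₁ ^ 3 = 0 := by
    have h5 : E'.g (T (t, x, u)) * (6 * ((du U (t, x, u) - q₂ * du T (t, x, u)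
        - fderiv ℝ v₁' (T (t, x, u), X (t, x, u)) (0, 1) * du X (t, x, u)) * r₁ ^ 3)) = 0 := by
      rw [← h3]
      linear_combination hE₂ - hE₁ - hq
    have h6 := (mul_eq_zero.mp h5).resolve_left (E'.g_ne _ hI')
    have h7 := (mul_eq_zero.mp h6).resolve_left (by norm_num)
    exact (mul_eq_zero.mp h7).resolve_left hne
  have hr0 : r₁ = 0 := by simpa using hr
  rw [hr0, mul_zero, zero_add] at hr₁ hr₂
  exact (mul_eq_zero.mp hr₁).resolve_right fun h => by simp [h] at hr₂

lemma Connects.dx_T_du_T_eq_zero (hC : Connects Ω E E' fun p => (T p, X p, U p)) {p : ℝ × ℝ × ℝ}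
    (hp : p ∈ Ω) : dx T p = 0 ∧ du T p = 0 := by
  have key : ∀ m a, baseJacobian T X p m a * (dx T p + du T p * a) = 0 := fun m a => by
    by_cases hJ : baseJacobian T X p m a = 0
    · rw [hJ, zero_mul]
    · rw [hC.total_dx_T_eq_zero hp hJ, mul_zero]
  unfold baseJacobian at key
  set m1 := dt T p * dx X p - dx T p * dt X p with hm1
  set m2 := du T p * dx X p - dx T p * du X p with hm2
  set m3 := dt T p * du X p - du T p * dt X p with hm3
  have key2 : ∀ m a, (m1 + m * m2 + a * m3) * (dx T p + du T p * a) = 0 := fun m a => by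
    linear_combination key m a
  -- The minors of the first two rows of the Jacobi matrix do not vanish together.
  have hne : ∀ y : ℝ, m1 * y = 0 → m2 * y = 0 → m3 * y = 0 → y = 0 := by
    intro y h1 h2 h3
    obtain ⟨r, s, w, a1, a2, -⟩ := hC.exists_solve hp 1 0 0
    obtain ⟨r', s', w', b1, b2, -⟩ := hC.exists_solve hp 0 1 0
    linear_combination (r * s' - r' * s) * h1 + (w * s' - w' * s) * h2 + (r * w' - r' * w) * h3
      - y * (dt X p * r' + dx X p * s' + du X p * w') * a1 - y * b2
      + y * (dt T p * r' + dx T p * s' + du T p * w') * a2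
  have k00 := key2 0 0
  have k10 := key2 1 0
  have k01 := key2 0 1
  have k02 := key2 0 (-1)
  have k11 := key2 1 1
  have e1 : m1 * dx T p = 0 := by linear_combination k00
  have e2 : m2 * dx T p = 0 := by linear_combination k10 - k00
  have e3 : m3 * du T p = 0 := by linear_combination (k01 + k02) / 2 - e1
  have e4 : m1 * du T p + m3 * dx T p = 0 := by linear_combination (k01 - k02) / 2
  have e5 : m2 * du T p = 0 := by linear_combination k11 - k01 - e2
  have e6 : m1 * du T p = 0 := by
    have : (m1 * du T p) * (m1 * du T p) = 0 := by
      linear_combination m1 * du T p * e4 - m1 * dx T p * e3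
    exact mul_self_eq_zero.mp this
  have e7 : m3 * dx T p = 0 := by linear_combination e4 - e6
  exact ⟨hne _ e1 e2 e7, hne _ e6 e5 e3⟩

lemma Connects.dt_T_ne_zero (hC : Connects Ω E E' fun p => (T p, X p, U p)) {p : ℝ × ℝ × ℝ}
    (hp : p ∈ Ω) : dt T p ≠ 0 := by
  intro h
  obtain ⟨a, b, c, h1, -, -⟩ := hC.exists_solve hp 1 0 0
  rw [h, (hC.dx_T_du_T_eq_zero hp).1, (hC.dx_T_du_T_eq_zero hp).2] at h1
  simp at h1

end Necessary

/-! ### Triangular form and comparison of coefficients -/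

section Determining

variable {Ω : Set (ℝ × ℝ × ℝ)} {E E' : Equation} {T X U : ℝ × ℝ × ℝ → ℝ}

/-- Sections `t = const` are mapped to sections `t̃ = const`. -/
lemma Connects.T_eq_of_section (hC : Connects Ω E E' fun p => (T p, X p, U p))
    (hsec : ∀ t : ℝ, IsPreconnected {y : ℝ × ℝ | (t, y) ∈ Ω}) :
    ∃ τ : ℝ → ℝ, (∀ p ∈ Ω, T p = τ p.1) ∧ ContDiffOn ℝ ∞ τ (Prod.fst '' Ω) ∧
      ∀ p ∈ Ω, HasDerivAt τ (dt T p) p.1 :=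
  exists_function_of_t hC.isOpen hsec hC.smooth_T (fun _ hp => (hC.dx_T_du_T_eq_zero hp).1)
    fun _ hp => (hC.dx_T_du_T_eq_zero hp).2

/-- Comparison of the coefficients of `u_xxx`. -/
lemma Connects.g_mul_total_dx_X (hC : Connects Ω E E' fun p => (T p, X p, U p))
    (hsec : ∀ t : ℝ, IsPreconnected {y : ℝ × ℝ | (t, y) ∈ Ω}) {p : ℝ × ℝ × ℝ} (hp : p ∈ Ω) {a : ℝ}
    (ha : dx X p + du X p * a ≠ 0) :
    E'.g (T p) * dt T p = E.g p.1 * (dx X p + du X p * a) ^ 3 := by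
  obtain ⟨τ, hτ, -, hτd⟩ := hC.T_eq_of_section hsec
  obtain ⟨t, x, u⟩ := p
  have hTx := (hC.dx_T_du_T_eq_zero hp).1
  have hTu := (hC.dx_T_du_T_eq_zero hp).2
  have hTt := hC.dt_T_ne_zero hp
  have hJ : ∀ m, baseJacobian T X (t, x, u) m a ≠ 0 := fun m => by
    simpa [baseJacobian, hTx, hTu] using And.intro hTt ha
  set m := -(u ^ E.n * a + E.h t * u) with hm
  obtain ⟨v₁', hs₁, he₁, hE₁, f1, f2⟩ := hC.exists_image hp (m := m) (c := 0) 0 0 (hJ _)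
    (by rw [hm]; ring)
  obtain ⟨v₂', hs₂, he₂, hE₂, f3, f4⟩ := hC.exists_image hp (m := m - 6 * E.g t) (c := 1) 0 0
    (hJ _) (by rw [hm]; ring)
  obtain ⟨γ, r₁, r₂, hγ0, hγ, hγT, hγX, hr₁, hr₂⟩ := exists_contact_curve hC.isOpen hC.smooth_T
    hC.smooth_X (v := jetPoly (t, x) u m a 0 0 0) (z := (t, x)) (p := (t, x, u)) (by simp) hp
    (contDiff_jetPoly _ _ _ _ _ _ _).contDiffAt (fderiv_jetPoly_fst _ _ _ _ _ _ _)
    (fderiv_jetPoly_snd _ _ _ _ _ _ _) (hJ m)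
  -- As `t̃` is a function of `t` with nonvanishing derivative, the curve stays in the section.
  have hγt : ∀ᶠ s in 𝓝 0, (γ s).1 = t := by
    have h1 : ∀ᶠ y in 𝓝 t, τ y = τ t → y = t := by
      have := (hτd _ hp).eventually_ne hTt (c := τ t)
      rw [eventually_nhdsWithin_iff] at this
      filter_upwards [this] with y hy h
      by_contra hne
      exact hy hne h
    have h2 : Tendsto (fun s => (γ s).1) (𝓝 0) (𝓝 t) := by
      have := (continuous_fst.continuousAt.comp hγ.continuousAt).tendsto
      simpa [Function.comp_def, hγ0] using this
    have h3 : ∀ᶠ s in 𝓝 0, ((γ s).1, (γ s).2, jetPoly (t, x) u m a 0 0 0 (γ s)) ∈ Ω := by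
      have hc : ContinuousAt (fun s => ((γ s).1, (γ s).2, jetPoly (t, x) u m a 0 0 0 (γ s))) 0 := by
        have hj := (contDiff_jetPoly (t, x) u m a 0 0 0).continuous
        have hc := hγ.continuousAt
        exact (continuous_fst.continuousAt.comp hc).prodMk ((continuous_snd.continuousAt.comp
          hc).prodMk (hj.continuousAt.comp hc))
      refine hc.eventually_mem (hC.isOpen.mem_nhds ?_)
      simpa [hγ0] using hp
    filter_upwards [h2.eventually h1, h3, hγT] with s e1 e2 e3
    rw [hτ _ e2, hτ _ hp] at e3
    exact e1 e3
  have hκ : Tendsto (fun s => (jetPoly (t, x) u (m - 6 * E.g t) a 0 1 0 (γ s)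
      - jetPoly (t, x) u m a 0 0 0 (γ s)) / s ^ 3) (𝓝[≠] 0) (𝓝 (r₂ ^ 3)) := by
    have hγ2 : HasDerivAt (fun s => (γ s).2) r₂ 0 := hγ.snd
    refine (tendsto_sub_pow_three_div hγ2 (c := x) (by simp [hγ0])).congr' ?_
    filter_upwards [hγt.filter_mono nhdsWithin_le_nhds] with s hs
    simp [jetPoly, hs]
  obtain ⟨-, hx, h3⟩ := prolongation_contact hC.isOpen hC.smooth_T hC.smooth_X hC.smooth_U hp
    (z := (t, x)) (contDiff_jetPoly _ _ _ _ _ _ _).continuous.continuousAt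
    (contDiff_jetPoly _ _ _ _ _ _ _).continuous.continuousAt (by simp) (by simp) hs₁ hs₂ he₁ he₂
    hγ.continuousAt hγ0 hγT hγX hκ
  have hne := hC.characteristic_ne_zero hp f3 f4
  rw [hx] at f3 f4 hE₂ h3 hne
  rw [hTx, hTu] at hr₁
  rw [hTu] at f1 f3 h3 hne
  have hr₁0 : r₁ = 0 := (mul_eq_zero.mp (by linear_combination hr₁ : r₁ * dt T (t, x, u) = 0))
    |>.resolve_right hTt
  rw [hr₁0, mul_zero, zero_add] at hr₂
  set q₁ := fderiv ℝ v₁' (T (t, x, u), X (t, x, u)) (1, 0)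
  set q₂ := fderiv ℝ v₂' (T (t, x, u), X (t, x, u)) (1, 0)
  set D := dx X (t, x, u) + du X (t, x, u) * a
  -- The second equation on the two images, with `v'_t̃` eliminated.
  have h5 : 6 * (du U (t, x, u) - q₂ * 0 - fderiv ℝ v₁' (T (t, x, u), X (t, x, u)) (0, 1)
      * du X (t, x, u)) * (E'.g (T (t, x, u)) * dt T (t, x, u) * r₂ ^ 3 - E.g t) = 0 := by
    linear_combination dt T (t, x, u) * (hE₂ - hE₁) - (f3 - f1)
      - E'.g (T (t, x, u)) * dt T (t, x, u) * h3
  have h6 := (mul_eq_zero.mp h5).resolve_left (mul_ne_zero (by norm_num) hne)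
  have h7 : (D * r₂) ^ 3 = 1 := by rw [hr₂]; norm_num
  simp only
  linear_combination D ^ 3 * h6 - E'.g (T (t, x, u)) * dt T (t, x, u) * h7

lemma Connects.du_X_eq_zero (hC : Connects Ω E E' fun p => (T p, X p, U p))
    (hsec : ∀ t : ℝ, IsPreconnected {y : ℝ × ℝ | (t, y) ∈ Ω}) {p : ℝ × ℝ × ℝ} (hp : p ∈ Ω) :
    du X p = 0 := by
  by_contra h
  have e1 : dx X p + du X p * ((1 - dx X p) / du X p) = 1 := by field_simp; ring
  have e2 : dx X p + du X p * ((2 - dx X p) / du X p) = 2 := by field_simp; ring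
  have h1 := hC.g_mul_total_dx_X hsec hp (a := (1 - dx X p) / du X p) (by rw [e1]; norm_num)
  have h2 := hC.g_mul_total_dx_X hsec hp (a := (2 - dx X p) / du X p) (by rw [e2]; norm_num)
  rw [e1] at h1
  rw [e2] at h2
  exact E.g_ne p.1 (hC.source hp).1 (by linarith)

lemma Connects.dx_X_ne_zero (hC : Connects Ω E E' fun p => (T p, X p, U p))
    (hsec : ∀ t : ℝ, IsPreconnected {y : ℝ × ℝ | (t, y) ∈ Ω}) {p : ℝ × ℝ × ℝ} (hp : p ∈ Ω) :
    dx X p ≠ 0 := by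
  intro h
  obtain ⟨a, b, c, h1, h2, -⟩ := hC.exists_solve hp 0 1 0
  rw [(hC.dx_T_du_T_eq_zero hp).1, (hC.dx_T_du_T_eq_zero hp).2] at h1
  rw [h, hC.du_X_eq_zero hsec hp] at h2
  have ha : a = 0 := by simpa [hC.dt_T_ne_zero hp] using h1
  simp [ha] at h2

lemma Connects.du_U_ne_zero (hC : Connects Ω E E' fun p => (T p, X p, U p))
    (hsec : ∀ t : ℝ, IsPreconnected {y : ℝ × ℝ | (t, y) ∈ Ω}) {p : ℝ × ℝ × ℝ} (hp : p ∈ Ω) :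
    du U p ≠ 0 := by
  intro h
  obtain ⟨a, b, c, h1, h2, h3⟩ := hC.exists_solve hp 0 0 1
  rw [(hC.dx_T_du_T_eq_zero hp).1, (hC.dx_T_du_T_eq_zero hp).2] at h1
  have ha : a = 0 := by simpa [hC.dt_T_ne_zero hp] using h1
  rw [hC.du_X_eq_zero hsec hp, ha] at h2
  have hb : b = 0 := by simpa [hC.dx_X_ne_zero hsec hp] using h2
  simp [ha, hb, h] at h3

lemma Connects.g_eq (hC : Connects Ω E E' fun p => (T p, X p, U p))
    (hsec : ∀ t : ℝ, IsPreconnected {y : ℝ × ℝ | (t, y) ∈ Ω}) {p : ℝ × ℝ × ℝ} (hp : p ∈ Ω) :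
    E'.g (T p) * dt T p = E.g p.1 * dx X p ^ 3 := by
  simpa using hC.g_mul_total_dx_X hsec hp (a := 0) (by simpa using hC.dx_X_ne_zero hsec hp)

lemma Connects.dx_X_eq_of_section (hC : Connects Ω E E' fun p => (T p, X p, U p))
    (hsec : ∀ t : ℝ, IsPreconnected {y : ℝ × ℝ | (t, y) ∈ Ω}) {p q : ℝ × ℝ × ℝ} (hp : p ∈ Ω)
    (hq : q ∈ Ω) (h : p.1 = q.1) : dx X p = dx X q := by
  obtain ⟨τ, hτ, -, hτd⟩ := hC.T_eq_of_section hsec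
  have h1 := hC.g_eq hsec hp
  have h2 := hC.g_eq hsec hq
  have h3 : dt T p = dt T q := by
    have h4 := hτd p hp
    rw [h] at h4
    exact h4.unique (hτd q hq)
  rw [hτ p hp, h3, h] at h1
  rw [hτ q hq, h1] at h2
  exact (Odd.strictMono_pow (by decide : Odd 3)).injective
    (mul_left_cancel₀ (E.g_ne _ (hC.source hq).1) h2)

lemma Connects.X_eq_of_section (hC : Connects Ω E E' fun p => (T p, X p, U p))
    (hsec : ∀ t : ℝ, IsPreconnected {y : ℝ × ℝ | (t, y) ∈ Ω}) {p q : ℝ × ℝ × ℝ} (hp : p ∈ Ω)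
    (hq : q ∈ Ω) (h : p.1 = q.1) : X q = X p + dx X p * (q.2.1 - p.2.1) := by
  set F : ℝ × ℝ × ℝ → ℝ := fun r => X r - dx X p * r.2.1 with hF
  have hFs : ContDiffOn ℝ ∞ F Ω := hC.smooth_X.sub (ContDiff.contDiffOn (by fun_prop))
  have hd : ∀ r ∈ Ω, ∀ a b c, fderiv ℝ F r (a, b, c)
      = dt X r * a + dx X r * b + du X r * c - dx X p * b := by
    intro r hr a b c
    have h1 : HasFDerivAt (fun p : ℝ × ℝ × ℝ => p.2.1)
        ((ContinuousLinearMap.fst ℝ ℝ ℝ).comp (ContinuousLinearMap.snd ℝ ℝ (ℝ × ℝ))) r :=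
      hasFDerivAt_fst.comp r hasFDerivAt_snd
    have h2 : HasFDerivAt F _ r :=
      (hasFDerivAt_of_mem hC.isOpen hC.smooth_X hr).sub (h1.const_mul (dx X p))
    rw [h2.fderiv]
    simp [fderiv_triple]
  have := eq_of_section hC.isOpen hsec hFs (p := p) (q := q) (fun r hr e => ?_) (fun r hr e => ?_)
    hp hq h
  · simp only [hF] at this
    linarith
  · change fderiv ℝ F r (0, 1, 0) = 0
    rw [hd r hr, hC.dx_X_eq_of_section hsec hr hp e]
    ring
  · change fderiv ℝ F r (0, 0, 1) = 0
    rw [hd r hr, hC.du_X_eq_zero hsec hr]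
    ring

/-- The second equation on the image of the jet of a parabola, in terms of the first variables. -/
lemma Connects.equation_on_parabola (hC : Connects Ω E E' fun p => (T p, X p, U p))
    (hsec : ∀ t : ℝ, IsPreconnected {y : ℝ × ℝ | (t, y) ∈ Ω}) {t x u : ℝ} (hp : (t, x, u) ∈ Ω)
    (a b : ℝ) :
    (dt U (t, x, u) - du U (t, x, u) * (u ^ E.n * a + E.h t * u)
        - (dx U (t, x, u) + du U (t, x, u) * a) / dx X (t, x, u) * dt X (t, x, u)) / dt T (t, x, u)
      + U (t, x, u) ^ E'.n * ((dx U (t, x, u) + du U (t, x, u) * a) / dx X (t, x, u))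
      + E'.h (T (t, x, u)) * U (t, x, u)
      + E'.g (T (t, x, u)) / dx X (t, x, u) ^ 3
        * iteratedDeriv 3 (fun y => U (t, y, u + a * (y - x) + b * (y - x) ^ 2)) x = 0 := by
  obtain ⟨τ, hτ, -, -⟩ := hC.T_eq_of_section hsec
  have hTx := (hC.dx_T_du_T_eq_zero hp).1
  have hTu := (hC.dx_T_du_T_eq_zero hp).2
  have hTt := hC.dt_T_ne_zero hp
  have hXu := hC.du_X_eq_zero hsec hp
  have hXx := hC.dx_X_ne_zero hsec hp
  set m := -(u ^ E.n * a + E.h t * u) with hm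
  obtain ⟨v', hs, he, hE, f1, f2⟩ := hC.exists_image hp (m := m) (a := a) (c := 0) b 0
    (by simpa [baseJacobian, hTx, hTu, hXu] using And.intro hTt hXx) (by rw [hm]; ring)
  have hline : (fun y => U (t, y, u + a * (y - x) + b * (y - x) ^ 2)) =ᶠ[𝓝 x]
      fun y => v' (T (t, x, u), dx X (t, x, u) * y + (X (t, x, u) - dx X (t, x, u) * x)) := by
    have h1 : Tendsto (fun y : ℝ => (t, y)) (𝓝 x) (𝓝 (t, x)) :=
      (by fun_prop : Continuous fun y : ℝ => (t, y)).tendsto x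
    have h2 : ∀ᶠ y in 𝓝 x, (t, y, u + a * (y - x) + b * (y - x) ^ 2) ∈ Ω :=
      (show ContinuousAt (fun y : ℝ => (t, y, u + a * (y - x) + b * (y - x) ^ 2)) x by
        fun_prop).eventually_mem (hC.isOpen.mem_nhds (by simpa using hp))
    filter_upwards [h1.eventually he, h2] with y hy hmem
    simp only [jetPoly, sub_self, mul_zero, zero_mul, add_zero, ne_eq, OfNat.ofNat_ne_zero,
      not_false_eq_true, zero_pow] at hy
    rw [← hy, hτ _ hmem, hτ _ hp, hC.X_eq_of_section hsec hp hmem rfl]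
    congr 2
    ring
  have h3 := hline.iteratedDeriv_eq 3
  rw [iteratedDeriv_comp_affine (fun y => v' (T (t, x, u), y))] at h3
  simp only [add_sub_cancel] at h3
  rw [h3]
  rw [hTx, hTu, hXu] at f2
  rw [hTu, hXu] at f1
  set q₁ := fderiv ℝ v' (T (t, x, u), X (t, x, u)) (1, 0)
  set q₂ := fderiv ℝ v' (T (t, x, u), X (t, x, u)) (0, 1)
  have e2 : (dx U (t, x, u) + du U (t, x, u) * a) / dx X (t, x, u) = q₂ := by
    rw [← f2]
    field_simp
    ring
  have e1 : (dt U (t, x, u) - du U (t, x, u) * (u ^ E.n * a + E.h t * u) - q₂ * dt X (t, x, u))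
      / dt T (t, x, u) = q₁ := by
    rw [div_eq_iff hTt]
    linear_combination -f1 + du U (t, x, u) * hm
  rw [e2, e1, ← hE]
  congr 1
  field_simp

/-- Comparison of the coefficients of `u_xx`. -/
lemma Connects.second_derivs_U (hC : Connects Ω E E' fun p => (T p, X p, U p))
    (hsec : ∀ t : ℝ, IsPreconnected {y : ℝ × ℝ | (t, y) ∈ Ω}) {p : ℝ × ℝ × ℝ} (hp : p ∈ Ω) :
    dx (du U) p = 0 ∧ du (du U) p = 0 := by
  obtain ⟨t, x, u⟩ := p
  have hg : E'.g (T (t, x, u)) / dx X (t, x, u) ^ 3 ≠ 0 :=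
    div_ne_zero (E'.g_ne _ (hC.target hp).1) (pow_ne_zero _ (hC.dx_X_ne_zero hsec hp))
  have key : ∀ a, dx (du U) (t, x, u) + a * du (du U) (t, x, u) = 0 := by
    intro a
    have h0 := hC.equation_on_parabola hsec hp a 0
    have h1 := hC.equation_on_parabola hsec hp a 1
    rw [iteratedDeriv_three_parabola hC.isOpen hC.smooth_U hp] at h0 h1
    refine (mul_eq_zero.mp ?_).resolve_left hg
    linear_combination (h1 - h0) / 6
  have k0 := key 0
  have k1 := key 1
  rw [zero_mul, add_zero] at k0
  exact ⟨k0, by rwa [k0, zero_add, one_mul] at k1⟩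

/-- As `U` is affine in `u` with a coefficient that depends on `t` only, `u_x` does not enter the
third derivative. -/
lemma Connects.equation_on_line (hC : Connects Ω E E' fun p => (T p, X p, U p))
    (hsec : ∀ t : ℝ, IsPreconnected {y : ℝ × ℝ | (t, y) ∈ Ω}) {t x u : ℝ} (hp : (t, x, u) ∈ Ω)
    (a : ℝ) :
    (dt U (t, x, u) - du U (t, x, u) * (u ^ E.n * a + E.h t * u)
        - (dx U (t, x, u) + du U (t, x, u) * a) / dx X (t, x, u) * dt X (t, x, u)) / dt T (t, x, u)
      + U (t, x, u) ^ E'.n * ((dx U (t, x, u) + du U (t, x, u) * a) / dx X (t, x, u))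
      + E'.h (T (t, x, u)) * U (t, x, u)
      + E'.g (T (t, x, u)) / dx X (t, x, u) ^ 3 * dx (dx (dx U)) (t, x, u) = 0 := by
  have h := hC.equation_on_parabola hsec hp a 0
  have hΩ := hC.isOpen
  have hU := hC.smooth_U
  have hxu : ∀ q ∈ Ω, dx (du U) q = 0 := fun q hq => (hC.second_derivs_U hsec hq).1
  have huu : ∀ q ∈ Ω, du (du U) q = 0 := fun q hq => (hC.second_derivs_U hsec hq).2
  have hux : ∀ q ∈ Ω, du (dx U) q = 0 := fun q hq => by
    rw [← dx_du_comm hΩ hU hq, hxu q hq]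
  have huxx : du (dx (dx U)) (t, x, u) = 0 := by
    rw [← dx_du_comm hΩ (contDiffOn_dx hΩ hU) hp, dx_eq_zero_of_eq_zero hΩ hux hp]
  rw [iteratedDeriv_three_parabola hΩ hU hp, huxx, dx_eq_zero_of_eq_zero hΩ hux hp,
    du_eq_zero_of_eq_zero hΩ hux hp, dx_eq_zero_of_eq_zero hΩ hxu hp,
    du_eq_zero_of_eq_zero hΩ hxu hp, dx_eq_zero_of_eq_zero hΩ huu hp,
    du_eq_zero_of_eq_zero hΩ huu hp] at h
  simpa using h

/-- Comparison of the coefficients of `u_x`. -/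
lemma Connects.power_relation (hC : Connects Ω E E' fun p => (T p, X p, U p))
    (hsec : ∀ t : ℝ, IsPreconnected {y : ℝ × ℝ | (t, y) ∈ Ω}) {p : ℝ × ℝ × ℝ} (hp : p ∈ Ω) :
    U p ^ E'.n * dt T p = dx X p * p.2.2 ^ E.n + dt X p := by
  obtain ⟨t, x, u⟩ := p
  have h0 := hC.equation_on_line hsec hp 0
  have h1 := hC.equation_on_line hsec hp 1
  have hTt := hC.dt_T_ne_zero hp
  have hXx := hC.dx_X_ne_zero hsec hp
  have hUu := hC.du_U_ne_zero hsec hp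
  have h2 : U (t, x, u) ^ E'.n * du U (t, x, u) / dx X (t, x, u)
      - (du U (t, x, u) * u ^ E.n + du U (t, x, u) / dx X (t, x, u) * dt X (t, x, u))
        / dt T (t, x, u) = 0 := by
    linear_combination h1 - h0
  field_simp at h2
  refine mul_left_cancel₀ hUu ?_
  simp only
  linear_combination h2

end Determining

/-! ### The exponents -/

section Powers

variable {Ω : Set (ℝ × ℝ × ℝ)} {E E' : Equation} {T X U : ℝ × ℝ × ℝ → ℝ}

lemma eq_of_hasDerivAt_of_eventuallyEq {f g : ℝ → ℝ} {f' g' x : ℝ} (hf : HasDerivAt f f' x)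
    (hg : HasDerivAt g g' x) (h : ∀ᶠ y in 𝓝 x, f y = g y) : f' = g' :=
  hf.unique (hg.congr_of_eventuallyEq h)

/-- Near any point, the points of the same `u`-line at which both powers can be differentiated are
dense. -/
lemma Connects.eventually_ne (hC : Connects Ω E E' fun p => (T p, X p, U p))
    (hsec : ∀ t : ℝ, IsPreconnected {y : ℝ × ℝ | (t, y) ∈ Ω}) {t x u : ℝ} (hp : (t, x, u) ∈ Ω) :
    ∀ᶠ w in 𝓝[≠] u, (t, x, w) ∈ Ω ∧ w ≠ 0 ∧ U (t, x, w) ≠ 0 := by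
  have h1 : ∀ᶠ w in 𝓝[≠] u, (t, x, w) ∈ Ω :=
    (eventually_mem_line_u hC.isOpen hp).filter_mono nhdsWithin_le_nhds
  have h2 : ∀ᶠ w in 𝓝[≠] u, w ≠ 0 := (hasDerivAt_id u).eventually_ne one_ne_zero
  have h3 : ∀ᶠ w in 𝓝[≠] u, U (t, x, w) ≠ 0 :=
    (hasDerivAt_line_u hC.isOpen hC.smooth_U hp).eventually_ne (hC.du_U_ne_zero hsec hp)
  exact h1.and (h2.and h3)

/-- An identity between continuous functions holds on the whole domain if it holds where both powers
can be differentiated. -/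
lemma Connects.eq_of_forall_ne (hC : Connects Ω E E' fun p => (T p, X p, U p))
    (hsec : ∀ t : ℝ, IsPreconnected {y : ℝ × ℝ | (t, y) ∈ Ω}) {F G : ℝ × ℝ × ℝ → ℝ}
    (h : ∀ p ∈ Ω, p.2.2 ≠ 0 → U p ≠ 0 → F p = G p) {p : ℝ × ℝ × ℝ} (hp : p ∈ Ω)
    (hF : ContinuousAt F p) (hG : ContinuousAt G p) : F p = G p := by
  obtain ⟨t, x, u⟩ := p
  have hc : Tendsto (fun w : ℝ => (t, x, w)) (𝓝[≠] u) (𝓝 (t, x, u)) :=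
    ((by fun_prop : Continuous fun w : ℝ => (t, x, w)).tendsto u).mono_left nhdsWithin_le_nhds
  refine tendsto_nhds_unique ((hF.tendsto.comp hc).congr' ?_) (hG.tendsto.comp hc)
  filter_upwards [hC.eventually_ne hsec hp] with w hw
  exact h _ hw.1 hw.2.1 hw.2.2

/-- The `u`-derivative of the relation between the powers. -/
lemma Connects.power_relation_deriv (hC : Connects Ω E E' fun p => (T p, X p, U p))
    (hsec : ∀ t : ℝ, IsPreconnected {y : ℝ × ℝ | (t, y) ∈ Ω}) {p : ℝ × ℝ × ℝ} (hp : p ∈ Ω)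
    (hu : p.2.2 ≠ 0) (hUp : U p ≠ 0) :
    E'.n * U p ^ (E'.n - 1) * du U p * dt T p = E.n * dx X p * p.2.2 ^ (E.n - 1) := by
  obtain ⟨t, x, u⟩ := p
  have hΩ := hC.isOpen
  have hTt : du (dt T) (t, x, u) = 0 := by
    rw [du_dt_comm hΩ hC.smooth_T hp]
    exact dt_eq_zero_of_eq_zero hΩ (fun q hq => (hC.dx_T_du_T_eq_zero hq).2) hp
  have hXx : du (dx X) (t, x, u) = 0 := by
    rw [← dx_du_comm hΩ hC.smooth_X hp]
    exact dx_eq_zero_of_eq_zero hΩ (fun q hq => hC.du_X_eq_zero hsec hq) hp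
  have hXt : du (dt X) (t, x, u) = 0 := by
    rw [du_dt_comm hΩ hC.smooth_X hp]
    exact dt_eq_zero_of_eq_zero hΩ (fun q hq => hC.du_X_eq_zero hsec hq) hp
  have d1 := ((hasDerivAt_line_u hΩ hC.smooth_U hp).rpow_const (p := E'.n) (Or.inl hUp)).mul
    (hasDerivAt_line_u hΩ (contDiffOn_dt hΩ hC.smooth_T) hp)
  have d2 := ((hasDerivAt_line_u hΩ (contDiffOn_dx hΩ hC.smooth_X) hp).mul
    ((hasDerivAt_id u).rpow_const (p := E.n) (Or.inl hu))).add
    (hasDerivAt_line_u hΩ (contDiffOn_dt hΩ hC.smooth_X) hp)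
  have h := eq_of_hasDerivAt_of_eventuallyEq d1 d2 (by
    filter_upwards [eventually_mem_line_u hΩ hp] with w hw
    exact hC.power_relation hsec hw)
  simp only [hTt, hXx, hXt, id] at h
  simp only
  linear_combination h

/-- The logarithmic derivative of the relation between the derivatives of the powers. -/
lemma Connects.exponent_relation (hC : Connects Ω E E' fun p => (T p, X p, U p))
    (hsec : ∀ t : ℝ, IsPreconnected {y : ℝ × ℝ | (t, y) ∈ Ω}) {p : ℝ × ℝ × ℝ} (hp : p ∈ Ω)
    (hu : p.2.2 ≠ 0) (hUp : U p ≠ 0) :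
    (E'.n - 1) * (du U p * p.2.2) = (E.n - 1) * U p := by
  have hpow : p.2.2 ^ (E.n - 1) ≠ 0 := by
    rw [Real.rpow_sub_one hu]
    exact div_ne_zero (rpow_ne_zero_of_mem (hC.source hp).2 hu) hu
  obtain ⟨t, x, u⟩ := p
  have hΩ := hC.isOpen
  have hTt : du (dt T) (t, x, u) = 0 := by
    rw [du_dt_comm hΩ hC.smooth_T hp]
    exact dt_eq_zero_of_eq_zero hΩ (fun q hq => (hC.dx_T_du_T_eq_zero hq).2) hp
  have hXx : du (dx X) (t, x, u) = 0 := by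
    rw [← dx_du_comm hΩ hC.smooth_X hp]
    exact dx_eq_zero_of_eq_zero hΩ (fun q hq => hC.du_X_eq_zero hsec hq) hp
  have hUuu := (hC.second_derivs_U hsec hp).2
  have dU := hasDerivAt_line_u hΩ hC.smooth_U hp
  have d1 := (((dU.rpow_const (p := E'.n - 1) (Or.inl hUp)).const_mul E'.n).mul
    (hasDerivAt_line_u hΩ (contDiffOn_du hΩ hC.smooth_U) hp)).mul
    (hasDerivAt_line_u hΩ (contDiffOn_dt hΩ hC.smooth_T) hp)
  have d2 := ((hasDerivAt_line_u hΩ (contDiffOn_dx hΩ hC.smooth_X) hp).const_mul E.n).mul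
    ((hasDerivAt_id u).rpow_const (p := E.n - 1) (Or.inl hu))
  have h := eq_of_hasDerivAt_of_eventuallyEq d1 d2 (by
    filter_upwards [eventually_mem_line_u hΩ hp, dU.continuousAt.eventually_ne hUp,
      eventually_ne_nhds hu] with w hw h1 h2
    exact hC.power_relation_deriv hsec hw h2 h1)
  have h0 := hC.power_relation_deriv hsec hp hu hUp
  simp only [hTt, hXx, hUuu, id] at h h0 hu hpow ⊢
  rw [Real.rpow_sub_one hUp (E'.n - 1), Real.rpow_sub_one hu (E.n - 1)] at h
  have hne : E.n * dx X (t, x, u) * u ^ (E.n - 1) ≠ 0 :=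
    mul_ne_zero (mul_ne_zero E.n_ne (hC.dx_X_ne_zero hsec hp)) hpow
  refine mul_left_cancel₀ hne ?_
  field_simp at h
  linear_combination h - (E'.n - 1) * du U (t, x, u) * u * h0

/-- Differentiating once more in `u`, the exponents agree. -/
lemma Connects.exponent_eq (hC : Connects Ω E E' fun p => (T p, X p, U p))
    (hsec : ∀ t : ℝ, IsPreconnected {y : ℝ × ℝ | (t, y) ∈ Ω}) (hne : Ω.Nonempty) :
    E'.n = E.n := by
  obtain ⟨⟨t, x, u₀⟩, hp₀⟩ := hne
  obtain ⟨u, hp, hu, hUp⟩ := (hC.eventually_ne hsec hp₀).exists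
  have hΩ := hC.isOpen
  have dU := hasDerivAt_line_u hΩ hC.smooth_U hp
  have d1 := ((hasDerivAt_line_u hΩ (contDiffOn_du hΩ hC.smooth_U) hp).mul
    (hasDerivAt_id u)).const_mul (E'.n - 1)
  have h := eq_of_hasDerivAt_of_eventuallyEq d1 (dU.const_mul (E.n - 1)) (by
    filter_upwards [eventually_mem_line_u hΩ hp, dU.continuousAt.eventually_ne hUp,
      eventually_ne_nhds hu] with w hw h1 h2
    exact hC.exponent_relation hsec hw h2 h1)
  rw [(hC.second_derivs_U hsec hp).2] at h
  refine mul_right_cancel₀ (hC.du_U_ne_zero hsec hp) ?_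
  simp only [zero_mul, zero_add, mul_one] at h
  linear_combination h

lemma Connects.U_eq (hC : Connects Ω E E' fun p => (T p, X p, U p))
    (hsec : ∀ t : ℝ, IsPreconnected {y : ℝ × ℝ | (t, y) ∈ Ω}) (h1 : E.n ≠ 1) {p : ℝ × ℝ × ℝ}
    (hp : p ∈ Ω) : U p = du U p * p.2.2 := by
  refine hC.eq_of_forall_ne hsec (F := U) (G := fun p => du U p * p.2.2) (fun q hq hu hUq => ?_) hp
    (contDiffAt_of_mem hC.isOpen hC.smooth_U hp).continuousAt
    ((contDiffAt_of_mem hC.isOpen (contDiffOn_du hC.isOpen hC.smooth_U) hp).continuousAt.mul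
      (by fun_prop))
  have h := hC.exponent_relation hsec hq hu hUq
  rw [hC.exponent_eq hsec ⟨q, hq⟩] at h
  exact (mul_left_cancel₀ (sub_ne_zero.mpr h1) h).symm

lemma Connects.du_U_mem_powDomain (hC : Connects Ω E E' fun p => (T p, X p, U p))
    (hsec : ∀ t : ℝ, IsPreconnected {y : ℝ × ℝ | (t, y) ∈ Ω}) (h1 : E.n ≠ 1) {p : ℝ × ℝ × ℝ}
    (hp : p ∈ Ω) : du U p ∈ powDomain E.n := by
  have h := (hC.target hp).2
  rw [hC.exponent_eq hsec ⟨p, hp⟩] at h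
  simp only at h
  rw [hC.U_eq hsec h1 hp] at h
  exact mem_powDomain_of_mul (hC.du_U_ne_zero hsec hp) (hC.source hp).2 h

lemma Connects.dt_X_eq_zero (hC : Connects Ω E E' fun p => (T p, X p, U p))
    (hsec : ∀ t : ℝ, IsPreconnected {y : ℝ × ℝ | (t, y) ∈ Ω}) (h1 : E.n ≠ 1) {p : ℝ × ℝ × ℝ}
    (hp : p ∈ Ω) : dt X p = 0 := by
  refine hC.eq_of_forall_ne hsec (F := dt X) (G := fun _ => 0) (fun q hq hu hUq => ?_) hp
    (contDiffAt_of_mem hC.isOpen (contDiffOn_dt hC.isOpen hC.smooth_X) hp).continuousAt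
    continuousAt_const
  have h2 := hC.power_relation hsec hq
  have h3 := hC.power_relation_deriv hsec hq hu hUq
  rw [hC.exponent_eq hsec ⟨q, hq⟩] at h2 h3
  rw [Real.rpow_sub_one hUq, Real.rpow_sub_one hu] at h3
  have hn := E.n_ne
  have h4 := hC.U_eq hsec h1 hq
  field_simp at h3
  have h5 : U q * (U q ^ E.n * dt T q) = U q * (dx X q * q.2.2 ^ E.n) := by
    linear_combination h3 + U q ^ E.n * dt T q * h4
  have h6 := mul_left_cancel₀ hUq h5
  linear_combination h6 - h2

lemma Connects.rpow_du_U_mul_dt_T (hC : Connects Ω E E' fun p => (T p, X p, U p))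
    (hsec : ∀ t : ℝ, IsPreconnected {y : ℝ × ℝ | (t, y) ∈ Ω}) (h1 : E.n ≠ 1) {p : ℝ × ℝ × ℝ}
    (hp : p ∈ Ω) : du U p ^ E.n * dt T p = dx X p := by
  have hΩ := hC.isOpen
  refine hC.eq_of_forall_ne hsec (F := fun p => du U p ^ E.n * dt T p) (G := dx X)
    (fun q hq hu hUq => ?_) hp
    (((contDiffAt_of_mem hΩ (contDiffOn_du hΩ hC.smooth_U) hp).continuousAt.rpow_const
      (Or.inl (hC.du_U_ne_zero hsec hp))).mul
      (contDiffAt_of_mem hΩ (contDiffOn_dt hΩ hC.smooth_T) hp).continuousAt)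
    (contDiffAt_of_mem hΩ (contDiffOn_dx hΩ hC.smooth_X) hp).continuousAt
  have h2 := hC.power_relation hsec hq
  have hq2 := (hC.source hq).2
  rw [hC.exponent_eq hsec ⟨q, hq⟩, hC.dt_X_eq_zero hsec h1 hq, hC.U_eq hsec h1 hq,
    mul_rpow_of_mem (hC.du_U_mem_powDomain hsec h1 hq) hq2] at h2
  refine mul_right_cancel₀ (rpow_ne_zero_of_mem hq2 hu) ?_
  linear_combination h2

lemma Connects.dx_U_eq_zero (hC : Connects Ω E E' fun p => (T p, X p, U p))
    (hsec : ∀ t : ℝ, IsPreconnected {y : ℝ × ℝ | (t, y) ∈ Ω}) (h1 : E.n ≠ 1) {p : ℝ × ℝ × ℝ}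
    (hp : p ∈ Ω) : dx U p = 0 := by
  obtain ⟨t, x, u⟩ := p
  have hΩ := hC.isOpen
  have h := eq_of_hasDerivAt_of_eventuallyEq (hasDerivAt_line_x hΩ hC.smooth_U hp)
    ((hasDerivAt_line_x hΩ (contDiffOn_du hΩ hC.smooth_U) hp).mul_const u) (by
      filter_upwards [eventually_mem_line_x hΩ hp] with y hy
      exact hC.U_eq hsec h1 hy)
  rw [h, (hC.second_derivs_U hsec hp).1, zero_mul]

/-- Comparison of the terms without derivatives. -/
lemma Connects.h_relation (hC : Connects Ω E E' fun p => (T p, X p, U p))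
    (hsec : ∀ t : ℝ, IsPreconnected {y : ℝ × ℝ | (t, y) ∈ Ω}) (h1 : E.n ≠ 1) {p : ℝ × ℝ × ℝ}
    (hp : p ∈ Ω) : dt U p + dt T p * E'.h (T p) * U p = du U p * E.h p.1 * p.2.2 := by
  obtain ⟨t, x, u⟩ := p
  have hΩ := hC.isOpen
  have hUx : ∀ q ∈ Ω, dx U q = 0 := fun q hq => hC.dx_U_eq_zero hsec h1 hq
  have h := hC.equation_on_line hsec hp 0
  have hTt := hC.dt_T_ne_zero hp
  rw [dx_eq_zero_of_eq_zero hΩ (fun q hq => dx_eq_zero_of_eq_zero hΩ hUx hq) hp, hUx _ hp,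
    hC.dt_X_eq_zero hsec h1 hp] at h
  field_simp at h
  simp only
  linear_combination h

end Powers

/-! ### The form of the transformations -/

section Form

variable {n : ℝ} {Ω : Set (ℝ × ℝ × ℝ)} {E E' : Equation} {T X U : ℝ × ℝ × ℝ → ℝ}

lemma IsRegularDomain.ordConnected (hΩ : IsRegularDomain n Ω) : (Prod.fst '' Ω).OrdConnected :=
  (hΩ.isConnected.isPreconnected.image _ continuous_fst.continuousOn).ordConnected

/-- The `(t, x, u)`-part of the stated form. -/
lemma Connects.exists_form (hC : Connects Ω E E' fun p => (T p, X p, U p))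
    (hΩ : IsRegularDomain n Ω) (hn : E.n = n) (h1 : n ≠ 1) {t₀ : ℝ} (h₀ : t₀ ∈ Prod.fst '' Ω) :
    ∃ (ε₀ ε₁ ε₂ : ℝ) (θ : ℝ → ℝ), ε₁ ≠ 0 ∧ ContDiffOn ℝ ∞ θ (Prod.fst '' Ω) ∧
      (∀ t ∈ Prod.fst '' Ω, θ t ≠ 0 ∧ θ t ∈ powDomain n) ∧
      (∀ p ∈ Ω, T p = ε₁ * (∫ s in t₀..p.1, θ s ^ (-n)) + ε₂) ∧
      (∀ p ∈ Ω, X p = ε₁ * p.2.1 + ε₀) ∧ (∀ p ∈ Ω, U p = θ p.1 * p.2.2) ∧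
      (∀ p ∈ Ω, dx X p = ε₁) ∧ (∀ p ∈ Ω, du U p = θ p.1) := by
  subst hn
  have hsec := hΩ.sections
  obtain ⟨p₀, hp₀⟩ := hΩ.isConnected.nonempty
  have hUs := contDiffOn_du hC.isOpen hC.smooth_U
  have hXs := contDiffOn_dx hC.isOpen hC.smooth_X
  obtain ⟨θ, hθ, hθs, -⟩ := exists_function_of_t hC.isOpen hsec hUs
    (fun _ hr => (hC.second_derivs_U hsec hr).1) (fun _ hr => (hC.second_derivs_U hsec hr).2)
  obtain ⟨τ, hτ, hτs, hτd⟩ := hC.T_eq_of_section hsec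
  -- All derivatives of `X_x` vanish.
  have hXxt : ∀ p ∈ Ω, dt (dx X) p = 0 := fun p hp => by
    rw [← dx_dt_comm hC.isOpen hC.smooth_X hp]
    exact dx_eq_zero_of_eq_zero hC.isOpen (fun q hq => hC.dt_X_eq_zero hsec h1 hq) hp
  have hXxu : ∀ p ∈ Ω, du (dx X) p = 0 := fun p hp => by
    rw [← dx_du_comm hC.isOpen hC.smooth_X hp]
    exact dx_eq_zero_of_eq_zero hC.isOpen (fun q hq => hC.du_X_eq_zero hsec hq) hp
  have hXxx : ∀ p ∈ Ω, dx (dx X) p = 0 := fun p hp =>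
    dx_eq_zero_of_section hC.isOpen hXs (fun q hq r hr h => hC.dx_X_eq_of_section hsec hq hr h) hp
  obtain ⟨c, hc⟩ := exists_eq_mul_add_const hC.isOpen hΩ.isConnected.isPreconnected hp₀ hXs hXxt
    hXxu fun p hp => by rw [hXxx p hp, hXxx p₀ hp₀]
  have hXc : ∀ p ∈ Ω, dx X p = dx X p₀ := fun p hp => by
    rw [hc p hp, hc p₀ hp₀, hXxx p₀ hp₀]
    ring
  obtain ⟨ε₀, hε₀⟩ := exists_eq_mul_add_const hC.isOpen hΩ.isConnected.isPreconnected hp₀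
    hC.smooth_X (fun p hp => hC.dt_X_eq_zero hsec h1 hp) (fun p hp => hC.du_X_eq_zero hsec hp) hXc
  have hθ0 : ∀ t ∈ Prod.fst '' Ω, θ t ≠ 0 ∧ θ t ∈ powDomain E.n := by
    rintro _ ⟨p, hp, rfl⟩
    rw [← hθ p hp]
    exact ⟨hC.du_U_ne_zero hsec hp, hC.du_U_mem_powDomain hsec h1 hp⟩
  refine ⟨ε₀, dx X p₀, τ t₀, θ, hC.dx_X_ne_zero hsec hp₀, hθs, hθ0, fun p hp => ?_, hε₀,
    fun p hp => ?_, hXc, hθ⟩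
  · have hI := isOpen_image_fst hC.isOpen
    have hK := contDiffOn_rpow hθs (fun t ht => (hθ0 t ht).1) (-E.n)
    have hd : ∀ t ∈ Prod.fst '' Ω, HasDerivAt
        (fun t => τ t - dx X p₀ * ∫ s in t₀..t, θ s ^ (-E.n)) 0 t := by
      rintro _ ⟨q, hq, rfl⟩
      have hqI : q.1 ∈ Prod.fst '' Ω := ⟨q, hq, rfl⟩
      refine ((hτd q hq).sub ((hasDerivAt_integral hI hΩ.ordConnected hK.continuousOn h₀
        hqI).const_mul (dx X p₀))).congr_deriv ?_
      have h2 := hC.rpow_du_U_mul_dt_T hsec h1 hq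
      rw [hθ q hq, hXc q hq] at h2
      rw [rpow_neg_of_mem (hθ0 _ hqI).2, ← h2]
      field_simp [rpow_ne_zero_of_mem (hθ0 _ hqI).2 (hθ0 _ hqI).1]
      ring
    have hconst := hI.is_const_of_deriv_eq_zero hΩ.ordConnected.isPreconnected
      (fun t ht => (hd t ht).differentiableAt.differentiableWithinAt)
      (fun t ht => (hd t ht).deriv) (⟨p, hp, rfl⟩ : p.1 ∈ Prod.fst '' Ω) h₀
    simp only [intervalIntegral.integral_same] at hconst
    rw [hτ p hp]
    linarith
  · rw [hC.U_eq hsec h1 hp, hθ p hp]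

/-- The coefficients of the second equation, for a transformation of the stated form. -/
lemma Connects.coefficients (hC : Connects Ω E E' fun p => (T p, X p, U p))
    (hΩ : IsRegularDomain n Ω) (hn : E.n = n) (h1 : n ≠ 1) {ε₁ : ℝ} {θ : ℝ → ℝ}
    (hXx : ∀ p ∈ Ω, dx X p = ε₁) (hUu : ∀ p ∈ Ω, du U p = θ p.1) {p : ℝ × ℝ × ℝ} (hp : p ∈ Ω) :
    E'.n = n ∧ E'.g (T p) = ε₁ ^ 2 * θ p.1 ^ n * E.g p.1 ∧
      E'.h (T p) = θ p.1 ^ n / ε₁ * (E.h p.1 - deriv θ p.1 / θ p.1) := by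
  subst hn
  have hsec := hΩ.sections
  have hε : ε₁ ≠ 0 := by
    rw [← hXx p hp]
    exact hC.dx_X_ne_zero hsec hp
  have hT : θ p.1 ^ E.n * dt T p = ε₁ := by
    rw [← hUu p hp, ← hXx p hp]
    exact hC.rpow_du_U_mul_dt_T hsec h1 hp
  have hTt := hC.dt_T_ne_zero hp
  refine ⟨hC.exponent_eq hsec ⟨p, hp⟩, ?_, ?_⟩
  · have h2 := hC.g_eq hsec hp
    rw [hXx p hp] at h2
    refine mul_right_cancel₀ hTt ?_
    linear_combination h2 - ε₁ ^ 2 * E.g p.1 * hT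
  · -- The relation is divided by `u`, at a point of the section with `u ≠ 0`.
    obtain ⟨τ, hτ, -, hτd⟩ := hC.T_eq_of_section hsec
    obtain ⟨t, x, u₀⟩ := p
    obtain ⟨u, hq, hu, -⟩ := (hC.eventually_ne hsec hp).exists
    have hθ0 : θ t ≠ 0 := by
      rw [← hUu _ hq]
      exact hC.du_U_ne_zero hsec hq
    have hTT : T (t, x, u) = T (t, x, u₀) := by rw [hτ _ hq, hτ _ hp]
    have hdT : dt T (t, x, u) = dt T (t, x, u₀) := (hτd _ hq).unique (hτd _ hp)
    obtain ⟨θ', hθ', -, hθd⟩ := exists_function_of_t hC.isOpen hsec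
      (contDiffOn_du hC.isOpen hC.smooth_U) (fun _ hr => (hC.second_derivs_U hsec hr).1)
      (fun _ hr => (hC.second_derivs_U hsec hr).2)
    have hd : HasDerivAt θ (dt (du U) (t, x, u)) t := by
      refine (hθd _ hq).congr_of_eventuallyEq ?_
      filter_upwards [(isOpen_image_fst hC.isOpen).mem_nhds ⟨_, hq, rfl⟩]
      rintro _ ⟨r, hr, rfl⟩
      rw [← hUu r hr, hθ' r hr]
    have hUt : dt U (t, x, u) = deriv θ t * u := by
      have e1 := hasDerivAt_comp_curve hC.isOpen hC.smooth_U (a := fun s => s) (b := fun _ => x)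
        (c := fun _ => u) (s := t) hq (hasDerivAt_id _) (hasDerivAt_const _ _)
        (hasDerivAt_const _ _)
      have hev : ∀ᶠ s in 𝓝 t, (s, x, u) ∈ Ω :=
        (show ContinuousAt (fun s : ℝ => (s, x, u)) t by fun_prop).eventually_mem
          (hC.isOpen.mem_nhds hq)
      have e2 := eq_of_hasDerivAt_of_eventuallyEq e1 (hd.mul_const u) (by
        filter_upwards [hev] with s hs
        rw [hC.U_eq hsec h1 hs, hUu _ hs])
      rw [hd.deriv]
      linear_combination e2
    have h2 := hC.h_relation hsec h1 hq
    rw [hUt, hC.U_eq hsec h1 hq, hUu _ hq, hTT, hdT] at h2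
    simp only at h2 hT hTt ⊢
    have h3 : deriv θ t + dt T (t, x, u₀) * E'.h (T (t, x, u₀)) * θ t = θ t * E.h t := by
      refine mul_right_cancel₀ hu ?_
      linear_combination h2
    have hK : θ t ^ E.n ≠ 0 := left_ne_zero_of_mul (hT.trans_ne hε)
    refine mul_left_cancel₀ (mul_ne_zero hTt hθ0) ?_
    rw [← hT]
    field_simp
    linear_combination h3

end Form

/-! ### Equivalence group, normalization and gauging -/

section Theorem

variable {n : ℝ} {Ω : Set (ℝ × ℝ × ℝ)}

lemma IsEquivalence.exists_hasForm (hn0 : n ≠ 0) (hn1 : n ≠ 1) (hΩ : IsRegularDomain n Ω)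
    {t₀ : ℝ} (h₀ : t₀ ∈ Prod.fst '' Ω) {𝒯 : ExtMap} (h : IsEquivalence n Ω 𝒯) :
    ∃ (ε₀ ε₁ ε₂ : ℝ) (θ : ℝ → ℝ), HasForm n Ω t₀ ε₀ ε₁ ε₂ θ 𝒯 := by
  -- Constant coefficients `g`, `h` take all admissible values.
  let Ec : ∀ a : ℝ, a ≠ 0 → ℝ → Equation := fun a ha b =>
    { n := n
      I := Set.univ
      g := fun _ => a
      h := fun _ => b
      n_ne := hn0
      isOpen_I := isOpen_univ
      ordConnected_I := Set.ordConnected_univ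
      nonempty_I := Set.univ_nonempty
      g_smooth := contDiffOn_const
      h_smooth := contDiffOn_const
      g_ne := fun _ _ => ha }
  obtain ⟨E₁, -, hC₁⟩ := h.preserves (Ec 1 one_ne_zero 0) rfl (Set.subset_univ _)
  obtain ⟨ε₀, ε₁, ε₂, θ, hε, hθs, hθ, hT, hX, hU, hXx, hUu⟩ := hC₁.exists_form hΩ rfl hn1 h₀
  have key : ∀ p ∈ Ω, ∀ a b : ℝ, a ≠ 0 → 𝒯.N p a b = n ∧ 𝒯.G p a b = ε₁ ^ 2 * θ p.1 ^ n * a ∧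
      𝒯.H p a b = θ p.1 ^ n / ε₁ * (b - deriv θ p.1 / θ p.1) := by
    intro p hp a b ha
    obtain ⟨E', hE', hC⟩ := h.preserves (Ec a ha b) rfl (Set.subset_univ _)
    obtain ⟨-, -, e1, e2, e3⟩ := hE' p hp
    obtain ⟨c1, c2, c3⟩ := hC.coefficients hΩ rfl hn1 hXx hUu hp
    exact ⟨e1.symm.trans c1, e2.symm.trans c2, e3.symm.trans c3⟩
  exact ⟨ε₀, ε₁, ε₂, θ, hε, hθs, hθ, hT, hX, hU, fun p hp a b ha => (key p hp a b ha).1,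
    fun p hp a b ha => (key p hp a b ha).2.1, fun p hp a b ha => (key p hp a b ha).2.2⟩

/-- Every point transformation between equations of the class is induced by an equivalence
transformation. -/
lemma Connects.exists_isEquivalence (hn1 : n ≠ 1) (hΩ : IsRegularDomain n Ω)
    {E E' : Equation} {Φ : ℝ × ℝ × ℝ → ℝ × ℝ × ℝ} (hE : E.n = n) (hC : Connects Ω E E' Φ) :
    ∃ 𝒯 : ExtMap, 𝒯.Φ = Φ ∧ IsEquivalence n Ω 𝒯 ∧ 𝒯.Takes Ω E E' := by
  obtain ⟨p₀, hp₀⟩ := hΩ.isConnected.nonempty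
  have h₀ : p₀.1 ∈ Prod.fst '' Ω := ⟨p₀, hp₀, rfl⟩
  have hC' : Connects Ω E E' fun p => ((Φ p).1, (Φ p).2.1, (Φ p).2.2) := hC
  obtain ⟨ε₀, ε₁, ε₂, θ, hε, hθs, hθ, hT, hX, hU, hXx, hUu⟩ := hC'.exists_form hΩ hE hn1 h₀
  let 𝒯 : ExtMap :=
    { Φ := Φ
      N := fun _ _ _ => n
      G := fun p a _ => ε₁ ^ 2 * θ p.1 ^ n * a
      H := fun p _ b => θ p.1 ^ n / ε₁ * (b - deriv θ p.1 / θ p.1) }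
  have hF : HasForm n Ω p₀.1 ε₀ ε₁ ε₂ θ 𝒯 :=
    ⟨hε, hθs, hθ, hT, hX, hU, fun _ _ _ _ _ => rfl, fun _ _ _ _ _ => rfl, fun _ _ _ _ _ => rfl⟩
  refine ⟨𝒯, rfl, hF.isEquivalence hΩ.isOpen hΩ.ordConnected h₀ hΩ.pow_defined, fun p hp => ?_⟩
  exact ⟨(hC.source hp).1, (hC.target hp).1, hC'.coefficients hΩ hE hn1 hXx hUu hp⟩

/-- Whether a transformation connects two equations depends on the second one only through its
coefficients on the image. -/
lemma IsEquivalence.connects (hne : Ω.Nonempty) {E E' : Equation} {𝒯 : ExtMap}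
    (h : IsEquivalence n Ω 𝒯) (hE : E.n = n) (hT : 𝒯.Takes Ω E E') : Connects Ω E E' 𝒯.Φ := by
  have hEI : Prod.fst '' Ω ⊆ E.I := by
    rintro _ ⟨p, hp, rfl⟩
    exact (hT p hp).1
  obtain ⟨E'', hT'', hC⟩ := h.preserves E hE hEI
  have hn : E'.n = E''.n := by
    obtain ⟨p, hp⟩ := hne
    exact (hT p hp).2.2.1.trans (hT'' p hp).2.2.1.symm
  refine ⟨hC.isOpen, hC.smooth, hC.jacobian_ne, hC.source, fun p hp => ?_, ?_⟩
  · refine ⟨(hT p hp).2.1, ?_⟩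
    rw [hn]
    exact (hC.target hp).2
  · intro v v' z hz hv hv' hd he
    rw [hC.jets v v' z hz hv hv' hd he]
    have e2 := (hT _ hz).2.2.2.1.trans (hT'' _ hz).2.2.2.1.symm
    have e3 := (hT _ hz).2.2.2.2.trans (hT'' _ hz).2.2.2.2.symm
    unfold Equation.HoldsAt
    rw [hn]
    simp only [baseMap, e2, e3]

lemma image_fst_dom (E : Equation) : Prod.fst '' E.dom = E.I := by
  ext t
  constructor
  · rintro ⟨p, hp, rfl⟩
    exact hp.1
  · intro ht
    exact ⟨(t, 0, 1), ⟨ht, mem_powDomain_of_pos one_pos⟩, rfl⟩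

lemma isOpen_powDomain (n : ℝ) : IsOpen (powDomain n) := by
  rw [isOpen_iff_mem_nhds]
  intro u hu
  rcases lt_trichotomy u 0 with h | rfl | h
  · have hk : ∃ k : ℤ, n = k := (pos_or_int hu).resolve_left h.not_gt
    filter_upwards [Iio_mem_nhds h] with w hw using Or.inr (Or.inl ⟨hw, hk⟩)
  · have hk : ∃ k : ℕ, n = k := by
      rcases hu with h | ⟨h, -⟩ | ⟨-, h⟩
      · exact absurd h (lt_irrefl _)
      · exact absurd h (lt_irrefl _)
      · exact h
    obtain ⟨k, rfl⟩ := hk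
    refine Filter.univ_mem' fun w => ?_
    rcases lt_trichotomy w 0 with h | h | h
    · exact Or.inr (Or.inl ⟨h, k, by simp⟩)
    · exact Or.inr (Or.inr ⟨h, k, rfl⟩)
    · exact Or.inl h
  · filter_upwards [Ioi_mem_nhds h] with w hw using Or.inl hw

lemma isOpen_dom (E : Equation) : IsOpen E.dom :=
  (E.isOpen_I.preimage continuous_fst).inter
    ((isOpen_powDomain E.n).preimage (continuous_snd.comp continuous_snd))

/-- The choice `θ = exp ∫ h` makes `h̃` vanish. -/
lemma exists_gauge (E : Equation) {t₀ : ℝ} (h₀ : t₀ ∈ E.I) :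
    ∃ (ε₀ ε₁ ε₂ : ℝ) (θ : ℝ → ℝ) (𝒯 : ExtMap) (E' : Equation),
      HasForm E.n E.dom t₀ ε₀ ε₁ ε₂ θ 𝒯 ∧ IsEquivalence E.n E.dom 𝒯 ∧
      𝒯.Takes E.dom E E' ∧ Connects E.dom E E' 𝒯.Φ ∧ ∀ s ∈ E'.I, E'.h s = 0 := by
  set θ : ℝ → ℝ := fun t => Real.exp (∫ s in t₀..t, E.h s) with hθdef
  have hθd : ∀ t ∈ E.I, HasDerivAt θ (θ t * E.h t) t := fun t ht =>
    (hasDerivAt_integral E.isOpen_I E.ordConnected_I E.h_smooth.continuousOn h₀ ht).exp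
  have hθs : ContDiffOn ℝ ∞ θ E.I :=
    (contDiffOn_of_hasDerivAt E.isOpen_I E.h_smooth fun t ht =>
      hasDerivAt_integral E.isOpen_I E.ordConnected_I E.h_smooth.continuousOn h₀ ht).exp
  have hθ0 : ∀ t, 0 < θ t := fun t => Real.exp_pos _
  let 𝒯 : ExtMap :=
    { Φ := fun p => (1 * (∫ s in t₀..p.1, θ s ^ (-E.n)) + 0, 1 * p.2.1 + 0, θ p.1 * p.2.2)
      N := fun _ _ _ => E.n
      G := fun p a _ => 1 ^ 2 * θ p.1 ^ E.n * a
      H := fun p _ b => θ p.1 ^ E.n / 1 * (b - deriv θ p.1 / θ p.1) }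
  have hF : HasForm E.n E.dom t₀ 0 1 0 θ 𝒯 :=
    ⟨one_ne_zero, by rwa [image_fst_dom], fun t _ => ⟨(hθ0 t).ne', mem_powDomain_of_pos (hθ0 t)⟩,
      fun _ _ => rfl, fun _ _ => rfl, fun _ _ => rfl, fun _ _ _ _ _ => rfl,
      fun _ _ _ _ _ => rfl, fun _ _ _ _ _ => rfl⟩
  have hI : (Prod.fst '' E.dom).OrdConnected := by
    rw [image_fst_dom]
    exact E.ordConnected_I
  have h₀' : t₀ ∈ Prod.fst '' E.dom := by rwa [image_fst_dom]
  have hpow : ∀ p ∈ E.dom, p.2.2 ∈ powDomain E.n := fun p hp => hp.2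
  obtain ⟨E', hT, hC, hE'⟩ := hF.exists_target (isOpen_dom E) hI h₀' hpow rfl
    (image_fst_dom E).subset
  refine ⟨0, 1, 0, θ, 𝒯, E', hF, hF.isEquivalence (isOpen_dom E) hI h₀' hpow, hT, hC,
    fun s hs => ?_⟩
  obtain ⟨p, hp, rfl⟩ := hE' hs
  simp only
  rw [(hT p hp).2.2.2.2]
  simp only [𝒯, (hθd _ hp.1).deriv]
  rw [mul_div_cancel_left₀ _ (hθ0 _).ne', sub_self, mul_zero]

end Theorem

end GKdV

theorem theorem1 (n : ℝ) (hn0 : n ≠ 0) (hn1 : n ≠ 1) :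
    (∀ Ω : Set (ℝ × ℝ × ℝ), GKdV.IsRegularDomain n Ω →
      -- the equivalence group
      (∀ t₀ ∈ Prod.fst '' Ω, ∀ 𝒯 : GKdV.ExtMap,
        GKdV.IsEquivalence n Ω 𝒯 ↔
          ∃ (ε₀ ε₁ ε₂ : ℝ) (θ : ℝ → ℝ), GKdV.HasForm n Ω t₀ ε₀ ε₁ ε₂ θ 𝒯) ∧
      -- normalization: the point transformations between equations of the class are exactly
      -- those induced by the equivalence group
      (∀ (E E' : GKdV.Equation) (Φ : ℝ × ℝ × ℝ → ℝ × ℝ × ℝ), E.n = n →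
        (GKdV.Connects Ω E E' Φ ↔
          ∃ 𝒯 : GKdV.ExtMap, 𝒯.Φ = Φ ∧ GKdV.IsEquivalence n Ω 𝒯 ∧ 𝒯.Takes Ω E E'))) ∧
    -- gauging `h` to zero on the whole domain of an equation
    (∀ E : GKdV.Equation, E.n = n → ∀ t₀ ∈ E.I,
      ∃ (ε₀ ε₁ ε₂ : ℝ) (θ : ℝ → ℝ) (𝒯 : GKdV.ExtMap) (E' : GKdV.Equation),
        GKdV.HasForm n E.dom t₀ ε₀ ε₁ ε₂ θ 𝒯 ∧ GKdV.IsEquivalence n E.dom 𝒯 ∧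
        𝒯.Takes E.dom E E' ∧ GKdV.Connects E.dom E E' 𝒯.Φ ∧ ∀ s ∈ E'.I, E'.h s = 0) := by
  refine ⟨fun Ω hΩ => ⟨fun t₀ h₀ 𝒯 => ⟨fun h => h.exists_hasForm hn0 hn1 hΩ h₀, ?_⟩,
    fun E E' Φ hE => ⟨fun hC => hC.exists_isEquivalence hn1 hΩ hE, ?_⟩⟩, ?_⟩
  · rintro ⟨ε₀, ε₁, ε₂, θ, hF⟩
    exact hF.isEquivalence hΩ.isOpen hΩ.ordConnected h₀ hΩ.pow_defined
  · rintro ⟨𝒯, rfl, h, hT⟩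
    exact h.connects hΩ.isConnected.nonempty hE hT
  · rintro E rfl t₀ h₀
    exact GKdV.exists_gauge E h₀
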